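/- **The algorithm.** Let $G=(V,E)$ be a finite simple graph with $n$ vertices and maximum degree $\Delta$, let $0<\epsilon\le 1/1000$, and let $C>0$ be a constant. Write $\log^{(i)}$ for the $i$-fold iterated (natural) logarithm. For $j\ge 0$ let $w_j=(1+\epsilon)^j/\Delta$, and $w_{-1}=0$. The phase $i(j)$ of round $j$ is the smallest $i\ge 1$ with $w_j\le (\log^{(i)}n)^{-5}$, and $p_i=\min\{1,\,C/(\log^{(i)}n)^4\}$. All vertices are active in round $0$. The rounds $j=0,1,2,\dots$ before the first one whose phase $i$ satisfies $1/\log^{(i)}n>\epsilon\log(1+\epsilon)/1000$ are sampling rounds; that round and all later ones are vanilla rounds. * In a sampling round $j$, for every $0\le h\le j$ a set $S_h^j\subseteq V$ is drawn by including each vertex with probability $p_{i(h)}$, all these choices (over all vertices, $h$ and $j$) being independent. Let $A_h^j$ be the set of the vertices of $S_h^j$ that were active in round $h$. Every active vertex $v$ with $$\tilde c_v=\sum_{h=0}^{j}\frac{|A_h^j\cap N(v)|}{p_{i(h)}}\,(w_h-w_{h-1})>1-10\epsilon$$ is frozen, i.e. it is not active in rounds later than $j$. * In a vanilla round $j$,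 every active vertex $v$ with $c_v=\sum_{e\ni v}x_e\ge 1-\epsilon$ is frozen, where $x_e=w_h$ for the last round $h\le j$ in which both endpoints of $e$ are active. The algorithm ends when no edge has two active endpoints. Let $\mathcal C$ be the set of all vertices that it freezes. **Theorem.** $\mathcal C$ is always a vertex cover of $G$, whatever the sampled sets are. Moreover, there are absolute constants $K,c_0>0$ such that for all $0<\epsilon\le 1/1000$, all $C\ge c_0/\epsilon^2$, and every graph $G$ on $n$ vertices whose minimum vertex cover $C^*$ satisfies $|C^*|\ge K(\log n)^{18}$, with probability at least $1-n^{-6}$ the set $\mathcal C$ is a $(2+100\epsilon)$-approximation of the minimum vertex cover, i.e. a vertex cover with $|\mathcal C|\le(2+100\epsilon)\,|C^*|$. -/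

import Mathlib

open MeasureTheory ProbabilityTheory

namespace LowAwake

noncomputable section

variable {V : Type*} [Fintype V]

open Classical in
/-- The weight `w_j = (1 + ε)^j / Δ` of the edges that are active in round `j`. -/
def weight (G : SimpleGraph V) (ε : ℝ) (j : ℕ) : ℝ :=
  (1 + ε) ^ j / (G.maxDegree : ℝ)

/-- The `i`-fold iterated natural logarithm of `n`. -/
def iterLog (n i : ℕ) : ℝ := Real.log^[i] (n : ℝ)

/-- The phase of round `j`: the smallest `i ≥ 1` with `w_j ≤ 1 / (log^(i) n)^5`. -/
def phase (G : SimpleGraph V) (ε : ℝ) (j : ℕ) : ℕ :=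
  sInf {i : ℕ | 1 ≤ i ∧ weight G ε j ≤ 1 / iterLog (Fintype.card V) i ^ 5}

/-- Round `j` belongs to the final, vanilla part of the algorithm, which starts with the first
round whose phase `i` satisfies `1 / log^(i) n > ε * log (1 + ε) / 1000`. -/
def IsVanillaRound (G : SimpleGraph V) (ε : ℝ) (j : ℕ) : Prop :=
  ∃ h ≤ j, ε * Real.log (1 + ε) / 1000 < 1 / iterLog (Fintype.card V) (phase G ε h)

open Classical in
/-- The probability `p_{i(h)}` with which the sets belonging to round `h` are sampled:
`C / (log^(i) n)^4` with `i` the phase of `h` (truncated at `1`), and `1` in the vanilla part. -/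
def samplingProb (G : SimpleGraph V) (ε C : ℝ) (h : ℕ) : ℝ :=
  if IsVanillaRound G ε h then 1
  else min 1 (C / iterLog (Fintype.card V) (phase G ε h) ^ 4)

/-! Below, `act h` is the set of nodes that are active in round `h`; what happens in round `j`
depends on `act h` for `h ≤ j` only. -/

open Classical in
/-- The value of the edge `uv` at the beginning of round `j`: `w_h`, where `h ≤ j` is the last
round in which both endpoints are active. -/
def edgeValue (G : SimpleGraph V) (ε : ℝ) (act : ℕ → Set V) (j : ℕ) (u v : V) : ℝ :=
  weight G ε (Nat.findGreatest (fun h => u ∈ act h ∧ v ∈ act h) j)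

open Classical in
/-- The true value `c_v` of the node `v` at the beginning of round `j`. -/
def nodeValue (G : SimpleGraph V) (ε : ℝ) (act : ℕ → Set V) (j : ℕ) (v : V) : ℝ :=
  ∑ u ∈ G.neighborFinset v, edgeValue G ε act j u v

/-- The increment `w_h - w_{h-1}`, with `w_{-1} = 0`. -/
def weightIncr (G : SimpleGraph V) (ε : ℝ) (h : ℕ) : ℝ :=
  if h = 0 then weight G ε 0 else weight G ε h - weight G ε (h - 1)

/-- The estimate of `c_v` in round `j`. Here `S h` is the set of nodes sampled in round `j` for
the previous round `h`, and `S h ∩ act h` is the set of those which were active in round `h`. -/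
def estimate (G : SimpleGraph V) (ε C : ℝ) (act : ℕ → Set V) (S : ℕ → Set V) (j : ℕ) (v : V) : ℝ :=
  ∑ h ∈ Finset.range (j + 1),
    ((S h ∩ act h ∩ G.neighborSet v).ncard : ℝ) / samplingProb G ε C h * weightIncr G ε h

/-- The rule by which an active node `v` is frozen in round `j`: in the vanilla part
the exact value `c_v` is compared to `1 - ε`, before that the estimate to `1 - 10 ε`. -/
def Freezes (G : SimpleGraph V) (ε C : ℝ) (act : ℕ → Set V) (S : ℕ → Set V) (j : ℕ) (v : V) :
    Prop :=
  (IsVanillaRound G ε j ∧ 1 - ε ≤ nodeValue G ε act j v) ∨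
    (¬ IsVanillaRound G ε j ∧ 1 - 10 * ε < estimate G ε C act S j v)

/-- The nodes that are active after round `j`. The algorithm has finished, and freezes no more
nodes, when no edge is active, i.e. when no edge has two active endpoints. -/
def nextActive (G : SimpleGraph V) (ε C : ℝ) (act : ℕ → Set V) (S : ℕ → Set V) (j : ℕ) : Set V :=
  {v ∈ act j | (∃ x ∈ act j, ∃ y ∈ act j, G.Adj x y) → ¬ Freezes G ε C act S j v}

/-- `history G ε C S j h` is, for `h ≤ j`, the set of nodes active in round `h` when the
algorithm is run with the sampled sets `S h j` (for round `h`, drawn in round `j ≥ h`). -/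
def history (G : SimpleGraph V) (ε C : ℝ) (S : ℕ → ℕ → Set V) : ℕ → ℕ → Set V
  | 0 => fun _ => Set.univ
  | j + 1 => fun h =>
      if h ≤ j then history G ε C S j h
      else nextActive G ε C (history G ε C S j) (fun h => S h j) j

/-- The set of nodes that are active in round `j`. -/
def active (G : SimpleGraph V) (ε C : ℝ) (S : ℕ → ℕ → Set V) (j : ℕ) : Set V :=
  history G ε C S j j

/-- The set of all nodes that are frozen by the algorithm. -/
def frozenSet (G : SimpleGraph V) (ε C : ℝ) (S : ℕ → ℕ → Set V) : Set V :=
  {v | ∃ j, v ∉ active G ε C S j}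

/-- The random sets `S ω h j` are distributed as the algorithm asks: all events `v ∈ S h j` are
mutually independent, and have the probability that belongs to round `h`. -/
structure IsSampling (G : SimpleGraph V) (ε C : ℝ) {Ω : Type*} [MeasurableSpace Ω]
    (μ : Measure Ω) (S : Ω → ℕ → ℕ → Set V) : Prop where
  measurableSet_mem : ∀ h j v, MeasurableSet {ω | v ∈ S ω h j}
  indep : iIndepSet (fun x : ℕ × ℕ × V => {ω | x.2.2 ∈ S ω x.1 x.2.1}) μ
  prob_mem : ∀ h j v, μ.real {ω | v ∈ S ω h j} = samplingProb G ε C h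

end

end LowAwake

namespace LowAwake

section Probability

variable {Ω ι : Type*} {E : ι → Set Ω}

/-- The random set of the indices of those events that occur. -/
def occurring (E : ι → Set Ω) (ω : Ω) : Set ι := {i | ω ∈ E i}

/-- A function of a set that only depends on the intersection of this set with `K`. -/
def DependsOnly {β : Type*} (φ : Set ι → β) (K : Finset ι) : Prop :=
  ∀ A, φ A = φ (A ∩ K)

lemma DependsOnly.mono {β : Type*} {φ : Set ι → β} {K L : Finset ι} (h : DependsOnly φ K)
    (hKL : K ⊆ L) : DependsOnly φ L := by
  intro A
  rw [h A, h (A ∩ L), Set.inter_assoc, Set.inter_eq_self_of_subset_right (s := (L : Set ι))]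
  exact_mod_cast hKL

lemma DependsOnly.comp {β γ : Type*} {φ : Set ι → β} {K : Finset ι} (h : DependsOnly φ K)
    (g : β → γ) : DependsOnly (fun A => g (φ A)) K := fun A => congrArg g (h A)

open Classical in
lemma occurring_factor {β : Type*} {φ : Set ι → β} {K : Finset ι} (h : DependsOnly φ K) :
    (fun ω => φ (occurring E ω)) =
      (fun t : K → Bool => φ {i | ∃ hi : i ∈ K, t ⟨i, hi⟩ = true}) ∘
        fun ω (i : K) => decide (ω ∈ E i) := by
  ext ω
  simp only [Function.comp]
  rw [h]
  congr 1
  ext i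
  simp [occurring, and_comm]

variable [MeasurableSpace Ω] {μ : Measure Ω}

open Classical in
lemma measurable_decide_mem (hE : ∀ i, MeasurableSet (E i)) (i : ι) :
    Measurable fun ω => decide (ω ∈ E i) :=
  measurable_to_bool (by simpa [Set.preimage] using hE i)

lemma measurable_occurring {β : Type*} [MeasurableSpace β] (hE : ∀ i, MeasurableSet (E i))
    {φ : Set ι → β} {K : Finset ι} (h : DependsOnly φ K) :
    Measurable fun ω => φ (occurring E ω) := by
  classical
  rw [occurring_factor h]
  exact (measurable_of_finite _).comp
    (measurable_pi_lambda _ fun i : K => measurable_decide_mem hE i.1)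

lemma indepFun_occurring {β γ : Type*} [MeasurableSpace β] [MeasurableSpace γ]
    (hE : ∀ i, MeasurableSet (E i)) (hi : iIndepSet E μ) {φ : Set ι → β} {ψ : Set ι → γ}
    {K L : Finset ι} (hφ : DependsOnly φ K) (hψ : DependsOnly ψ L) (hKL : Disjoint K L) :
    IndepFun (fun ω => φ (occurring E ω)) (fun ω => ψ (occurring E ω)) μ := by
  classical
  rw [occurring_factor hφ, occurring_factor hψ]
  have h1 : iIndepFun (fun i ω => decide (ω ∈ E i)) μ := by
    have := (hi.iIndepFun_indicator (β := ℕ)).comp (fun _ n => decide (n = 1))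
      (fun _ => measurable_from_top)
    convert this using 3 with i ω
    simp [Set.indicator_apply]
  exact (h1.indepFun_finset K L hKL (measurable_decide_mem hE)).comp
    (measurable_of_finite _) (measurable_of_finite _)

lemma integrable_occurring [IsFiniteMeasure μ] (hE : ∀ i, MeasurableSet (E i))
    {φ : Set ι → ℝ} {K : Finset ι} (h : DependsOnly φ K) :
    Integrable (fun ω => φ (occurring E ω)) μ := by
  classical
  obtain ⟨C, hC⟩ : ∃ C, ∀ P ∈ K.powerset, ‖φ P‖ ≤ C := by
    obtain ⟨C, hC⟩ := (K.powerset.image fun P : Finset ι => ‖φ P‖).bddAbove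
    exact ⟨C, fun P hP => hC (by simpa using ⟨P, by simpa using hP, rfl⟩)⟩
  refine Integrable.of_bound (measurable_occurring hE h).aestronglyMeasurable C
    (ae_of_all _ fun ω => ?_)
  rw [h]
  have := hC (K.filter (· ∈ occurring E ω)) (by simp)
  have hset : ((K.filter (· ∈ occurring E ω) : Finset ι) : Set ι) = occurring E ω ∩ K := by
    ext i; simp [and_comm]
  rwa [hset] at this

/-- If a property holds with probability at most `δ` for each value of a function of the past, then
it has probability at most `δ`. -/
lemma prob_le_of_past [IsProbabilityMeasure μ] (hE : ∀ i, MeasurableSet (E i))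
    (hi : iIndepSet E μ) {β : Type*} {φ : Set ι → β} {K L : Finset ι} (hφ : DependsOnly φ K)
    (hKL : Disjoint K L) (H : β → Prop) (B : β → Set ι → Prop)
    (hB : ∀ b, DependsOnly (B b) L) (δ : ℝ)
    (h : ∀ A, H (φ A) → μ.real {ω | B (φ A) (occurring E ω)} ≤ δ) (hδ : 0 ≤ δ) :
    μ.real {ω | H (φ (occurring E ω)) ∧ B (φ (occurring E ω)) (occurring E ω)} ≤ δ := by
  classical
  let past : Set ι → Finset ι := fun A => K.filter (· ∈ A)
  have hpast : DependsOnly past K := by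
    intro A; ext i; simp +contextual [past]
  have hφp : ∀ A, φ A = φ (past A) := by
    intro A; rw [hφ]; congr 1; ext i; simp [past, and_comm]
  let _ : MeasurableSpace (Finset ι) := ⊤
  have hm : Measurable fun ω => past (occurring E ω) := measurable_occurring hE hpast
  calc
    _ ≤ μ.real (⋃ P ∈ K.powerset, {ω | past (occurring E ω) = P ∧ H (φ P) ∧
          B (φ P) (occurring E ω)}) := by
        refine measureReal_mono (fun ω hω => ?_) (measure_ne_top _ _)
        simp only [Set.mem_iUnion, Set.mem_ofPred_eq]
        refine ⟨past (occurring E ω), by simp [past], rfl, ?_⟩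
        rw [← hφp]; exact hω
    _ ≤ ∑ P ∈ K.powerset, μ.real {ω | past (occurring E ω) = P ∧ H (φ P) ∧
          B (φ P) (occurring E ω)} := measureReal_biUnion_finset_le _ _
    _ ≤ ∑ P ∈ K.powerset, μ.real {ω | past (occurring E ω) = P} * δ := by
        refine Finset.sum_le_sum fun P hP => ?_
        by_cases hH : H (φ P)
        · have hind := indepFun_occurring (μ := μ) hE hi hpast (hB (φ P)) hKL
          have := hind.measure_inter_preimage_eq_mul {P} {True} trivial trivial
          have hset : {ω | past (occurring E ω) = P ∧ H (φ P) ∧ B (φ P) (occurring E ω)} =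
              (fun ω => past (occurring E ω)) ⁻¹' {P} ∩
                (fun ω => B (φ P) (occurring E ω)) ⁻¹' {True} := by
            ext ω; simp [hH]
          rw [hset, measureReal_def, this, ENNReal.toReal_mul]
          refine mul_le_mul_of_nonneg_left ?_ ENNReal.toReal_nonneg
          refine le_trans (le_of_eq ?_) (h P hH)
          rw [measureReal_def]; congr 2; ext ω; simp
        · have : {ω | past (occurring E ω) = P ∧ H (φ P) ∧ B (φ P) (occurring E ω)} = ∅ := by
            ext ω; simp [hH]
          rw [this]; simp only [measureReal_empty]; positivity
    _ = μ.real (⋃ P ∈ K.powerset, {ω | past (occurring E ω) = P}) * δ := by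
        rw [← Finset.sum_mul, measureReal_biUnion_finset]
        · intro P _ Q _ hPQ
          refine Set.disjoint_left.mpr fun ω h1 h2 => hPQ (h1.symm.trans h2)
        · intro P _
          exact hm (show MeasurableSet {P} from trivial)
    _ ≤ 1 * δ := by gcongr; exact measureReal_le_one
    _ = δ := one_mul δ

lemma integral_exp_sum_occurring [IsProbabilityMeasure μ] (hE : ∀ i, MeasurableSet (E i))
    (hi : iIndepSet E μ) {κ : Type*} (c : Finset κ) (φ : κ → Set ι → ℝ) (K : κ → Finset ι)
    (hφ : ∀ v ∈ c, DependsOnly (φ v) (K v))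
    (hK : ∀ v ∈ c, ∀ w ∈ c, v ≠ w → Disjoint (K v) (K w)) :
    ∫ ω, Real.exp (∑ v ∈ c, φ v (occurring E ω)) ∂μ =
      ∏ v ∈ c, ∫ ω, Real.exp (φ v (occurring E ω)) ∂μ := by
  classical
  induction c using Finset.induction_on with
  | empty => simp
  | insert a c ha ih =>
    rw [Finset.prod_insert ha, ← ih (fun v hv => hφ v (by simp [hv]))
      (fun v hv w hw => hK v (by simp [hv]) w (by simp [hw]))]
    have hd : DependsOnly (fun A => Real.exp (∑ v ∈ c, φ v A)) (c.biUnion K) := by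
      refine DependsOnly.comp (φ := fun A => ∑ v ∈ c, φ v A) (fun A => ?_) Real.exp
      refine Finset.sum_congr rfl fun v hv => ?_
      exact (hφ v (by simp [hv])).mono (Finset.subset_biUnion_of_mem K hv) A
    have hd' : DependsOnly (fun A => Real.exp (φ a A)) (K a) := (hφ a (by simp)).comp _
    have hdis : Disjoint (K a) (c.biUnion K) := by
      rw [Finset.disjoint_biUnion_right]
      exact fun w hw => hK a (by simp) w (by simp [hw]) (by rintro rfl; exact ha hw)
    have := (indepFun_occurring (μ := μ) hE hi hd' hd hdis).integral_fun_mul_eq_mul_integral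
      (measurable_occurring hE hd').aestronglyMeasurable
      (measurable_occurring hE hd).aestronglyMeasurable
    rw [← this]
    simp only [Finset.sum_insert ha, Real.exp_add]

lemma prob_ge_le_exp_integral [IsProbabilityMeasure μ] (hE : ∀ i, MeasurableSet (E i))
    {φ : Set ι → ℝ} {K : Finset ι} (h : DependsOnly φ K) (s : ℝ) :
    μ.real {ω | s ≤ φ (occurring E ω)} ≤
      Real.exp (-s) * ∫ ω, Real.exp (φ (occurring E ω)) ∂μ := by
  have := measure_ge_le_exp_mul_mgf (μ := μ) (X := fun ω => φ (occurring E ω)) s zero_le_one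
    (by simpa using integrable_occurring hE (h.comp Real.exp))
  simpa [mgf] using this

open Classical in
lemma integral_exp_ite [IsProbabilityMeasure μ] {p : Ω → Prop} (hp : MeasurableSet {ω | p ω})
    (x : ℝ) : ∫ ω, Real.exp (if p ω then x else 0) ∂μ =
      1 + μ.real {ω | p ω} * (Real.exp x - 1) := by
  have : (fun ω => Real.exp (if p ω then x else 0)) =
      fun ω => 1 + {ω | p ω}.indicator (fun _ => Real.exp x - 1) ω := by
    ext ω; by_cases h : p ω <;> simp [h]
  rw [this, integral_add (integrable_const _) ((integrable_const _).indicator hp),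
    integral_indicator_const _ hp]
  simp

open Classical in
/-- A Chernoff bound for a weighted sum of independent events. -/
lemma prob_weighted_sum_ge [IsProbabilityMeasure μ] (hE : ∀ i, MeasurableSet (E i))
    (hi : iIndepSet E μ) {κ : Type*} (c : Finset κ) (F : κ → Set ι → Prop) (K : κ → Finset ι)
    (hF : ∀ v ∈ c, DependsOnly (F v) (K v))
    (hK : ∀ v ∈ c, ∀ w ∈ c, v ≠ w → Disjoint (K v) (K w)) (b : κ → ℝ) {B : ℝ} (hB : 0 < B)
    (hb : ∀ v ∈ c, 0 ≤ b v ∧ b v ≤ B) (s : ℝ) :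
    μ.real {ω | 2 * ∑ v ∈ c, b v * μ.real {ω | F v (occurring E ω)} + s ≤
      ∑ v ∈ c, if F v (occurring E ω) then b v else 0} ≤ Real.exp (-(s / B)) := by
  set m := ∑ v ∈ c, b v * μ.real {ω | F v (occurring E ω)} with hm
  have hφ : ∀ v ∈ c, DependsOnly (fun A => if F v A then b v / B else 0) (K v) :=
    fun v hv A => by simp only [hF v hv A]
  have hsum : DependsOnly (fun A => ∑ v ∈ c, if F v A then b v / B else 0) (c.biUnion K) := by
    intro A
    refine Finset.sum_congr rfl fun v hv => ?_
    exact (hφ v hv).mono (Finset.subset_biUnion_of_mem K hv) A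
  have hprod : ∏ v ∈ c, ∫ ω, Real.exp (if F v (occurring E ω) then b v / B else 0) ∂μ ≤
      Real.exp (2 * m / B) := by
    have : Real.exp (2 * m / B) =
        ∏ v ∈ c, Real.exp (2 * (b v * μ.real {ω | F v (occurring E ω)}) / B) := by
      rw [← Real.exp_sum, ← Finset.sum_div, ← Finset.mul_sum]
    rw [this]
    refine Finset.prod_le_prod (fun v _ => integral_nonneg fun ω => (Real.exp_pos _).le) ?_
    intro v hv
    have hmeas : MeasurableSet {ω | F v (occurring E ω)} := by
      have := measurable_occurring (E := E) hE (hF v hv) (show MeasurableSet {True} from trivial)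
      convert this using 1; ext ω; simp
    rw [integral_exp_ite hmeas]
    obtain ⟨h0, h1⟩ := hb v hv
    have hx0 : 0 ≤ b v / B := by positivity
    have hx1 : b v / B ≤ 1 := (div_le_one hB).2 h1
    have hexp : Real.exp (b v / B) - 1 ≤ 2 * (b v / B) := by
      have := Real.abs_exp_sub_one_sub_id_le (x := b v / B) (by rw [abs_of_nonneg hx0]; exact hx1)
      have := (abs_le.1 this).2
      nlinarith
    have hpos : 0 ≤ μ.real {ω | F v (occurring E ω)} := measureReal_nonneg
    calc _ ≤ 2 * (b v * μ.real {ω | F v (occurring E ω)}) / B + 1 := by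
          have := mul_le_mul_of_nonneg_left hexp hpos
          have e : 2 * (b v * μ.real {ω | F v (occurring E ω)}) / B =
            μ.real {ω | F v (occurring E ω)} * (2 * (b v / B)) := by ring
          rw [e]; linarith
      _ ≤ _ := Real.add_one_le_exp _
  have hset : {ω | 2 * m + s ≤ ∑ v ∈ c, if F v (occurring E ω) then b v else 0} =
      {ω | (2 * m + s) / B ≤ ∑ v ∈ c, if F v (occurring E ω) then b v / B else 0} := by
    ext ω
    simp only [Set.mem_ofPred_eq]
    rw [div_le_iff₀ hB, Finset.sum_mul]
    simp [ite_mul, hB.ne']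
  rw [hset]
  refine (prob_ge_le_exp_integral hE hsum _).trans ?_
  rw [integral_exp_sum_occurring hE hi c _ K hφ hK]
  refine (mul_le_mul_of_nonneg_left hprod (Real.exp_pos _).le).trans (le_of_eq ?_)
  rw [← Real.exp_add]; congr 1; ring

/-- Greedy colouring. -/
lemma exists_coloring {κ : Type*} [DecidableEq κ] (A : Finset κ) (r : κ → κ → Prop)
    [DecidableRel r] (hr : ∀ v w, r v w → r w v) (d : ℕ)
    (hd : ∀ v ∈ A, (A.filter fun w => w ≠ v ∧ r v w).card ≤ d) :
    ∃ col : κ → Fin (d + 1), ∀ v ∈ A, ∀ w ∈ A, v ≠ w → r v w → col v ≠ col w := by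
  induction A using Finset.induction_on with
  | empty => exact ⟨fun _ => 0, by simp⟩
  | insert a A ha ih =>
    obtain ⟨col, hcol⟩ := ih fun v hv => (Finset.card_le_card
      (Finset.filter_subset_filter _ (Finset.subset_insert a A))).trans (hd v (by simp [hv]))
    have hcard : ((A.filter fun w => r a w).image col).card <
        (Finset.univ : Finset (Fin (d + 1))).card := by
      rw [Finset.card_univ, Fintype.card_fin, Nat.lt_succ_iff]
      refine Finset.card_image_le.trans ((Finset.card_le_card ?_).trans (hd a (by simp)))
      intro w hw
      rw [Finset.mem_filter] at hw ⊢
      exact ⟨by simp [hw.1], by rintro rfl; exact ha hw.1, hw.2⟩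
    obtain ⟨x, -, hx⟩ := Finset.exists_mem_notMem_of_card_lt_card hcard
    have hx' : ∀ w ∈ A, r a w → x ≠ col w := by
      rintro w hw hrw rfl
      exact hx (Finset.mem_image_of_mem _ (by simp [hw, hrw]))
    refine ⟨Function.update col a x, ?_⟩
    intro v hv w hw hvw hrvw
    rw [Finset.mem_insert] at hv hw
    rcases hv with rfl | hv
    · rcases hw with rfl | hw
      · exact absurd rfl hvw
      · rw [Function.update_self, Function.update_of_ne hvw.symm]
        exact hx' w hw hrvw
    · rcases hw with rfl | hw
      · rw [Function.update_self, Function.update_of_ne hvw]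
        exact (hx' v hv (hr _ _ hrvw)).symm
      · rw [Function.update_of_ne (by rintro rfl; exact ha hv),
          Function.update_of_ne (by rintro rfl; exact ha hw)]
        exact hcol v hv w hw hvw hrvw

open Classical in
/-- A Chernoff bound for a weighted sum of events with a dependency graph of bounded degree. -/
lemma prob_weighted_sum_ge_of_dependency [IsProbabilityMeasure μ] (hE : ∀ i, MeasurableSet (E i))
    (hi : iIndepSet E μ) {κ : Type*} (A : Finset κ) (F : κ → Set ι → Prop) (K : κ → Finset ι)
    (hF : ∀ v ∈ A, DependsOnly (F v) (K v)) (d : ℕ)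
    (hK : ∀ v ∈ A, (A.filter fun w => w ≠ v ∧ ¬ Disjoint (K v) (K w)).card ≤ d)
    (b : κ → ℝ) {B : ℝ} (hB : 0 < B) (hb : ∀ v ∈ A, 0 ≤ b v ∧ b v ≤ B) (s : ℝ) :
    μ.real {ω | 2 * ∑ v ∈ A, b v * μ.real {ω | F v (occurring E ω)} + (d + 1) * s <
      ∑ v ∈ A, if F v (occurring E ω) then b v else 0} ≤ (d + 1) * Real.exp (-(s / B)) := by
  obtain ⟨col, hcol⟩ := exists_coloring A (fun v w => ¬ Disjoint (K v) (K w))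
    (fun v w h => by rwa [disjoint_comm]) d hK
  have hsplit : ∀ f : κ → ℝ, ∑ v ∈ A, f v = ∑ x, ∑ v ∈ A.filter (fun v => col v = x), f v :=
    fun f => (Finset.sum_fiberwise A col f).symm
  calc
    _ ≤ μ.real (⋃ x ∈ (Finset.univ : Finset (Fin (d + 1))),
          {ω | 2 * ∑ v ∈ A.filter (fun v => col v = x), b v * μ.real {ω | F v (occurring E ω)} + s ≤
            ∑ v ∈ A.filter (fun v => col v = x), if F v (occurring E ω) then b v else 0}) := by
        refine measureReal_mono (fun ω hω => ?_) (measure_ne_top _ _)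
        simp only [Set.mem_iUnion, Set.mem_ofPred_eq, Finset.mem_univ, exists_true_left] at hω ⊢
        by_contra! hcon
        have := Finset.sum_le_sum fun x (_ : x ∈ Finset.univ) => (hcon x).le
        rw [← hsplit, Finset.sum_add_distrib, ← Finset.mul_sum, ← hsplit] at this
        simp at this
        linarith
    _ ≤ ∑ x : Fin (d + 1), Real.exp (-(s / B)) := by
        refine (measureReal_biUnion_finset_le _ _).trans (Finset.sum_le_sum fun x _ => ?_)
        refine prob_weighted_sum_ge hE hi _ F K (fun v hv => hF v (Finset.mem_filter.1 hv).1) ?_ b hB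
          (fun v hv => hb v (Finset.mem_filter.1 hv).1) s
        intro v hv w hw hvw
        rw [Finset.mem_filter] at hv hw
        by_contra hdis
        exact hcol v hv.1 w hw.1 hvw hdis (hv.2.trans hw.2.symm)
    _ = _ := by simp

open Classical in
lemma integral_exp_estimate_le [IsProbabilityMeasure μ] (hE : ∀ i, MeasurableSet (E i))
    (hi : iIndepSet E μ) (s : Finset ι) (α : ι → ℝ) {g : ℝ}
    (hp : ∀ i ∈ s, 0 < μ.real (E i)) (hα : ∀ i ∈ s, 0 ≤ α i ∧ α i / μ.real (E i) ≤ g)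
    {t : ℝ} (ht : |t| * g ≤ 1) :
    ∫ ω, Real.exp (∑ i ∈ s, if i ∈ occurring E ω then t * (α i / μ.real (E i)) else 0) ∂μ ≤
      Real.exp (t * ∑ i ∈ s, α i + t ^ 2 * g * ∑ i ∈ s, α i) := by
  rw [integral_exp_sum_occurring hE hi s
    (fun i A => if i ∈ A then t * (α i / μ.real (E i)) else 0) (fun i => {i})
    (fun i _ A => by simp) (fun i _ k _ hik => by simpa using hik)]
  rw [Finset.mul_sum, Finset.mul_sum, ← Finset.sum_add_distrib, Real.exp_sum]
  refine Finset.prod_le_prod (fun v _ => integral_nonneg fun ω => (Real.exp_pos _).le) ?_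
  intro i his
  have h0 := hp i his
  obtain ⟨h1, h2⟩ := hα i his
  rw [integral_exp_ite (p := fun ω => i ∈ occurring E ω) (hE i)]
  change 1 + μ.real (E i) * _ ≤ _
  set p := μ.real (E i)
  set y := α i / p with hy
  have hy0 : 0 ≤ y := by positivity
  have hαy : α i = p * y := by rw [hy]; field_simp
  have habs : |t * y| ≤ 1 := by
    rw [abs_mul, abs_of_nonneg hy0]
    exact (mul_le_mul_of_nonneg_left h2 (abs_nonneg t)).trans ht
  have hexp := (abs_le.1 (Real.abs_exp_sub_one_sub_id_le habs)).2
  have hg : p * (t * y) ^ 2 ≤ t ^ 2 * g * α i := by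
    rw [hαy]
    have := mul_le_mul_of_nonneg_left h2 (by positivity : 0 ≤ t ^ 2 * p * y)
    nlinarith
  calc 1 + p * (Real.exp (t * y) - 1) ≤ (t * α i + t ^ 2 * g * α i) + 1 := by
        have := mul_le_mul_of_nonneg_left hexp h0.le
        rw [hαy] at hg ⊢
        nlinarith
    _ ≤ _ := Real.add_one_le_exp _

open Classical in
/-- A Chernoff bound for the estimate of a sum from a random sample. -/
lemma prob_estimate_deviates [IsProbabilityMeasure μ] (hE : ∀ i, MeasurableSet (E i))
    (hi : iIndepSet E μ) (s : Finset ι) (α : ι → ℝ) {g M ε : ℝ} (hg : 0 < g)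
    (hε0 : 0 < ε) (hε1 : ε ≤ 1)
    (hp : ∀ i ∈ s, 0 < μ.real (E i)) (hα : ∀ i ∈ s, 0 ≤ α i ∧ α i / μ.real (E i) ≤ g)
    (hM : ∑ i ∈ s, α i ≤ M) :
    μ.real {ω | ε * M < |(∑ i ∈ s, if i ∈ occurring E ω then α i / μ.real (E i) else 0) -
      ∑ i ∈ s, α i|} ≤ 2 * Real.exp (-(ε ^ 2 * M / (4 * g))) := by
  set m := ∑ i ∈ s, α i with hm
  have hm0 : 0 ≤ m := Finset.sum_nonneg fun i his => (hα i his).1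
  have key : ∀ t : ℝ, |t| = ε / (2 * g) →
      μ.real {ω | t * m + |t| * (ε * M) ≤
        ∑ i ∈ s, if i ∈ occurring E ω then t * (α i / μ.real (E i)) else 0} ≤
      Real.exp (-(ε ^ 2 * M / (4 * g))) := by
    intro t ht
    have hdep : DependsOnly (fun A => ∑ i ∈ s, if i ∈ A then t * (α i / μ.real (E i)) else 0) s :=
      fun A => Finset.sum_congr rfl fun i his => by simp [his]
    refine (prob_ge_le_exp_integral hE hdep _).trans ?_
    refine (mul_le_mul_of_nonneg_left (integral_exp_estimate_le hE hi s α hp hα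
      (by rw [ht]; field_simp; linarith)) (Real.exp_pos _).le).trans ?_
    rw [← Real.exp_add, Real.exp_le_exp, ← hm, ← sq_abs t, ht]
    have h1 : (ε / (2 * g)) ^ 2 * g * m ≤ (ε / (2 * g)) ^ 2 * g * M := by gcongr
    have h2 : (ε / (2 * g)) ^ 2 * g * M = ε ^ 2 * M / (4 * g) := by field_simp; ring
    have h3 : ε / (2 * g) * (ε * M) = 2 * (ε ^ 2 * M / (4 * g)) := by field_simp; ring
    linarith
  have hpos : 0 < ε / (2 * g) := by positivity
  have hmul : ∀ (t : ℝ) (ω : Ω),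
      (∑ i ∈ s, if i ∈ occurring E ω then t * (α i / μ.real (E i)) else 0) =
        t * ∑ i ∈ s, if i ∈ occurring E ω then α i / μ.real (E i) else 0 := by
    intro t ω
    rw [Finset.mul_sum]; exact Finset.sum_congr rfl fun i _ => by simp
  have k1 := key (ε / (2 * g)) (abs_of_pos hpos)
  have k2 := key (-(ε / (2 * g))) (by rw [abs_neg, abs_of_pos hpos])
  rw [abs_of_pos hpos] at k1
  rw [abs_neg, abs_of_pos hpos] at k2
  refine (measureReal_mono ?_).trans ((measureReal_union_le _ _).trans
    ((add_le_add k1 k2).trans (two_mul _).ge))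
  intro ω hω
  simp only [Set.mem_ofPred_eq, Set.mem_union, hmul] at hω ⊢
  rcases lt_abs.1 hω with h | h
  · left
    have := mul_le_mul_of_nonneg_left h.le hpos.le
    linarith
  · right
    have := mul_le_mul_of_nonneg_left h.le hpos.le
    linarith

end Probability

section Deterministic

open scoped Classical

variable {V : Type*} [Fintype V] {G : SimpleGraph V} {ε C : ℝ}

lemma weight_nonneg (hε : 0 < ε) (j : ℕ) : 0 ≤ weight G ε j := by
  unfold weight; positivity

lemma weight_pos (hε : 0 < ε) (hG : 0 < G.maxDegree) (j : ℕ) : 0 < weight G ε j := by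
  unfold weight
  have : (0 : ℝ) < G.maxDegree := by exact_mod_cast hG
  positivity

lemma weight_succ (j : ℕ) : weight G ε (j + 1) = (1 + ε) * weight G ε j := by
  unfold weight; ring

lemma weight_mono (hε : 0 < ε) : Monotone (weight G ε) :=
  monotone_nat_of_le_succ fun j => by
    rw [weight_succ]; nlinarith [weight_nonneg (G := G) hε j]

lemma weightIncr_nonneg (hε : 0 < ε) (h : ℕ) : 0 ≤ weightIncr G ε h := by
  unfold weightIncr
  split_ifs
  · exact weight_nonneg hε 0
  · exact sub_nonneg.2 (weight_mono hε (Nat.sub_le h 1))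

lemma weightIncr_le (hε : 0 < ε) (h : ℕ) : weightIncr G ε h ≤ weight G ε h := by
  unfold weightIncr
  split_ifs with h0
  · rw [h0]
  · linarith [weight_nonneg (G := G) hε (h - 1)]

lemma sum_weightIncr (j : ℕ) :
    ∑ h ∈ Finset.range (j + 1), weightIncr G ε h = weight G ε j := by
  induction j with
  | zero => simp [weightIncr]
  | succ j ih => rw [Finset.sum_range_succ, ih]; simp [weightIncr]

/-- `IsShrinking act` says that all nodes are active at first, and that frozen nodes stay frozen. -/
structure IsShrinking (act : ℕ → Set V) : Prop where
  zero : act 0 = Set.univ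
  anti : Antitone act

variable {act : ℕ → Set V}

lemma edgeValue_comm (j : ℕ) (u v : V) :
    edgeValue G ε act j u v = edgeValue G ε act j v u := by
  unfold edgeValue; simp only [and_comm]

lemma edgeValue_nonneg (hε : 0 < ε) (j : ℕ) (u v : V) : 0 ≤ edgeValue G ε act j u v :=
  weight_nonneg hε _

lemma edgeValue_of_mem {j : ℕ} {u v : V} (hu : u ∈ act j) (hv : v ∈ act j) :
    edgeValue G ε act j u v = weight G ε j := by
  unfold edgeValue; rw [Nat.findGreatest_eq ⟨hu, hv⟩]

lemma edgeValue_succ_of_not {j : ℕ} {u v : V} (h : ¬ (u ∈ act (j + 1) ∧ v ∈ act (j + 1))) :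
    edgeValue G ε act (j + 1) u v = edgeValue G ε act j u v := by
  unfold edgeValue; rw [Nat.findGreatest_of_not h]

lemma weight_le_edgeValue (hε : 0 < ε) {l j : ℕ} (hlj : l ≤ j) {u v : V} (hu : u ∈ act l)
    (hv : v ∈ act l) : weight G ε l ≤ edgeValue G ε act j u v :=
  weight_mono hε (Nat.le_findGreatest hlj ⟨hu, hv⟩)

lemma edgeValue_succ_le (hε : 0 < ε) (ha : IsShrinking act) (j : ℕ) (u v : V) :
    edgeValue G ε act (j + 1) u v ≤ (1 + ε) * edgeValue G ε act j u v := by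
  by_cases h : u ∈ act (j + 1) ∧ v ∈ act (j + 1)
  · rw [edgeValue_of_mem h.1 h.2, edgeValue_of_mem (ha.anti j.le_succ h.1) (ha.anti j.le_succ h.2),
      weight_succ]
  · rw [edgeValue_succ_of_not h]
    nlinarith [edgeValue_nonneg (G := G) (act := act) hε j u v]

lemma edgeValue_eq_sum (ha : IsShrinking act) {j : ℕ} {v : V} (hv : v ∈ act j) (u : V) :
    edgeValue G ε act j u v =
      ∑ h ∈ Finset.range (j + 1), if u ∈ act h then weightIncr G ε h else 0 := by
  induction j with
  | zero => simp [edgeValue, weightIncr, ha.zero]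
  | succ j ih =>
    by_cases hu : u ∈ act (j + 1)
    · rw [edgeValue_of_mem hu hv, ← sum_weightIncr]
      refine Finset.sum_congr rfl fun h hh => ?_
      rw [if_pos (ha.anti (Nat.lt_succ_iff.1 (Finset.mem_range.1 hh)) hu)]
    · rw [edgeValue_succ_of_not (fun h => hu h.1), ih (ha.anti j.le_succ hv),
        Finset.sum_range_succ _ (j + 1), if_neg hu, add_zero]

lemma edgeValue_congr {act' : ℕ → Set V} {j : ℕ} (h : ∀ i ≤ j, act i = act' i) (u v : V) :
    edgeValue G ε act j u v = edgeValue G ε act' j u v := by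
  induction j with
  | zero => simp [edgeValue]
  | succ j ih =>
    unfold edgeValue at ih ⊢
    rw [Nat.findGreatest_succ, Nat.findGreatest_succ, h (j + 1) le_rfl]
    split_ifs
    · rfl
    · exact ih fun i hi => h i (hi.trans j.le_succ)

lemma nodeValue_congr {act' : ℕ → Set V} {j : ℕ} (h : ∀ i ≤ j, act i = act' i) (v : V) :
    nodeValue G ε act j v = nodeValue G ε act' j v :=
  Finset.sum_congr rfl fun _ _ => edgeValue_congr h _ _

lemma nodeValue_nonneg (hε : 0 < ε) (j : ℕ) (v : V) : 0 ≤ nodeValue G ε act j v :=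
  Finset.sum_nonneg fun _ _ => edgeValue_nonneg hε _ _ _

lemma ncard_inter_neighborSet (A : Set V) (v : V) :
    ((A ∩ G.neighborSet v).ncard : ℝ) = ∑ u ∈ G.neighborFinset v, if u ∈ A then (1 : ℝ) else 0 := by
  rw [Finset.sum_boole, Set.ncard_eq_toFinset_card']
  congr 2
  ext u; simp [and_comm]

lemma nodeValue_eq_sum (ha : IsShrinking act) {j : ℕ} {v : V} (hv : v ∈ act j) :
    nodeValue G ε act j v = ∑ h ∈ Finset.range (j + 1),
      ((act h ∩ G.neighborSet v).ncard : ℝ) * weightIncr G ε h := by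
  unfold nodeValue
  simp_rw [edgeValue_eq_sum ha hv]
  rw [Finset.sum_comm]
  refine Finset.sum_congr rfl fun h _ => ?_
  rw [ncard_inter_neighborSet, Finset.sum_mul]
  exact Finset.sum_congr rfl fun u _ => by simp

lemma nodeValue_succ_le (hε : 0 < ε) (ha : IsShrinking act) (j : ℕ) (v : V) :
    nodeValue G ε act (j + 1) v ≤ (1 + ε) * nodeValue G ε act j v := by
  unfold nodeValue
  rw [Finset.mul_sum]
  exact Finset.sum_le_sum fun u _ => edgeValue_succ_le hε ha j u v

lemma nodeValue_add_le (hε : 0 < ε) (ha : IsShrinking act) (j k : ℕ) (v : V) :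
    nodeValue G ε act (j + k) v ≤ (1 + ε) ^ k * nodeValue G ε act j v := by
  induction k with
  | zero => simp
  | succ k ih =>
    refine (nodeValue_succ_le hε ha (j + k) v).trans ?_
    rw [pow_succ']
    nlinarith [mul_le_mul_of_nonneg_left ih (by linarith : 0 ≤ 1 + ε)]

lemma nodeValue_zero_le (v : V) : nodeValue G ε act 0 v ≤ 1 := by
  have : nodeValue G ε act 0 v = (G.degree v : ℝ) * (1 / (G.maxDegree : ℝ)) := by
    simp [nodeValue, edgeValue, weight]
  rw [this, mul_one_div]
  exact div_le_one_of_le₀ (by exact_mod_cast G.degree_le_maxDegree v) (by positivity)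

lemma nodeValue_succ_eq_of_notMem {j : ℕ} {v : V} (hv : v ∉ act (j + 1)) :
    nodeValue G ε act (j + 1) v = nodeValue G ε act j v :=
  Finset.sum_congr rfl fun _ _ => edgeValue_succ_of_not fun h => hv h.2

lemma nodeValue_eq_of_notMem (ha : IsShrinking act) {f j : ℕ} (hfj : f ≤ j) {v : V}
    (hv : v ∉ act (f + 1)) : nodeValue G ε act j v = nodeValue G ε act f v := by
  induction j, hfj using Nat.le_induction with
  | base => rfl
  | succ j hj ih =>
    rw [nodeValue_succ_eq_of_notMem fun h => hv (ha.anti (by omega) h), ih]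

lemma weight_le_nodeValue (hε : 0 < ε) {l j : ℕ} (hlj : l ≤ j) {u v : V} (huv : G.Adj v u)
    (hu : u ∈ act l) (hv : v ∈ act l) : weight G ε l ≤ nodeValue G ε act j v :=
  (weight_le_edgeValue hε hlj hu hv).trans
    (Finset.single_le_sum (s := G.neighborFinset v) (f := fun u => edgeValue G ε act j u v)
      (fun _ _ => edgeValue_nonneg hε _ _ _) (by simpa using huv))

lemma ncard_mul_weight_le_nodeValue (hε : 0 < ε) {j : ℕ} {v : V} (hv : v ∈ act j) :
    ((act j ∩ G.neighborSet v).ncard : ℝ) * weight G ε j ≤ nodeValue G ε act j v := by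
  rw [ncard_inter_neighborSet, Finset.sum_mul]
  refine Finset.sum_le_sum fun u _ => ?_
  split_ifs with hu
  · rw [one_mul, edgeValue_of_mem hu hv]
  · rw [zero_mul]; exact edgeValue_nonneg hε _ _ _

lemma sum_nodeValue_le (hε : 0 < ε) {D : Finset V} (hD : G.IsVertexCover (D : Set V)) (j : ℕ) :
    ∑ v, nodeValue G ε act j v ≤ 2 * ∑ v ∈ D, nodeValue G ε act j v := by
  let e : V → V → ℝ := fun v u => if G.Adj v u then edgeValue G ε act j u v else 0
  have hsymm : ∀ u v, e u v = e v u := fun u v => by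
    simp only [e, G.adj_comm u v, edgeValue_comm j u v]
  have he : ∀ u v, 0 ≤ e u v := fun u v => by
    simp only [e]; split_ifs <;> simp [edgeValue_nonneg hε]
  have key : ∀ v, nodeValue G ε act j v = ∑ u, e v u := by
    intro v
    unfold nodeValue
    rw [← Finset.sum_filter]
    refine Finset.sum_congr ?_ fun _ _ => rfl
    ext u; simp
  calc ∑ v, nodeValue G ε act j v
      ≤ ∑ v, ∑ u, ((if v ∈ D then e v u else 0) + if u ∈ D then e v u else 0) := by
        refine Finset.sum_le_sum fun v _ => ?_
        rw [key]
        refine Finset.sum_le_sum fun u _ => ?_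
        by_cases huv : G.Adj v u
        · have h0 := he v u
          rcases hD huv with h | h
          · rw [if_pos (by exact_mod_cast h)]
            split_ifs <;> linarith
          · rw [if_pos (c := u ∈ D) (by exact_mod_cast h)]
            split_ifs <;> linarith
        · simp [e, huv]
    _ = 2 * ∑ v ∈ D, nodeValue G ε act j v := by
        simp_rw [Finset.sum_add_distrib]
        rw [two_mul]
        congr 1
        · simp_rw [key]
          rw [← Finset.sum_subset (Finset.subset_univ D) (fun v _ hv => by simp [hv])]
          exact Finset.sum_congr rfl fun v hv => by simp [hv]
        · rw [Finset.sum_comm]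
          simp_rw [key]
          rw [← Finset.sum_subset (Finset.subset_univ D) (fun v _ hv => by simp [hv])]
          exact Finset.sum_congr rfl fun v hv => by simp [hv, hsymm]

lemma estimate_congr {act' S S' : ℕ → Set V} {j : ℕ} (h : ∀ i ≤ j, act i = act' i)
    (hS : ∀ i ≤ j, S i = S' i) (v : V) :
    estimate G ε C act S j v = estimate G ε C act' S' j v := by
  refine Finset.sum_congr rfl fun i hi => ?_
  have hij := Nat.lt_succ_iff.1 (Finset.mem_range.1 hi)
  rw [h i hij, hS i hij]

lemma freezes_congr {act' S S' : ℕ → Set V} {j : ℕ} (h : ∀ i ≤ j, act i = act' i)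
    (hS : ∀ i ≤ j, S i = S' i) (v : V) :
    Freezes G ε C act S j v ↔ Freezes G ε C act' S' j v := by
  unfold Freezes
  rw [nodeValue_congr h, estimate_congr h hS]

lemma nextActive_congr {act' S S' : ℕ → Set V} {j : ℕ} (h : ∀ i ≤ j, act i = act' i)
    (hS : ∀ i ≤ j, S i = S' i) :
    nextActive G ε C act S j = nextActive G ε C act' S' j := by
  unfold nextActive
  simp only [freezes_congr h hS, h j le_rfl]

variable {S : ℕ → ℕ → Set V}

lemma history_eq_active (j h : ℕ) : history G ε C S j h = active G ε C S (min h j) := by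
  induction j with
  | zero => simp [active, history]
  | succ j ih =>
    by_cases hh : h ≤ j
    · rw [min_eq_left (by omega)]
      rw [min_eq_left hh] at ih
      simp only [history, if_pos hh, ih]
    · rw [min_eq_right (by omega)]
      simp [active, history, hh]

lemma active_succ (j : ℕ) : active G ε C S (j + 1) =
    nextActive G ε C (active G ε C S) (fun h => S h j) j := by
  have : active G ε C S (j + 1) = nextActive G ε C (history G ε C S j) (fun h => S h j) j := by
    simp [active, history]
  rw [this]
  exact nextActive_congr (fun i hi => by rw [history_eq_active, min_eq_left hi]) fun _ _ => rfl

lemma isShrinking_active : IsShrinking (active G ε C S) where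
  zero := by simp [active, history]
  anti := antitone_nat_of_succ_le fun j => by
    rw [active_succ]; exact Set.sep_subset _ _

lemma isShrinking_history (j : ℕ) : IsShrinking (history G ε C S j) where
  zero := by rw [history_eq_active]; simp [isShrinking_active.zero]
  anti := fun a b hab => by
    rw [history_eq_active, history_eq_active]
    exact isShrinking_active.anti (min_le_min_right j hab)

lemma history_congr {S' : ℕ → ℕ → Set V} (j : ℕ) (h : ∀ i < j, ∀ l ≤ i, S l i = S' l i) :
    history G ε C S j = history G ε C S' j := by
  induction j with
  | zero => rfl
  | succ j ih =>
    have ih' := ih fun i hi => h i (hi.trans j.lt_succ_self)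
    funext l
    simp only [history, ih']
    rw [nextActive_congr (fun _ _ => rfl) (h j j.lt_succ_self)]

/-- In round `j` the estimate of `c_v` is far from the truth. -/
def Misjudged (G : SimpleGraph V) (ε C : ℝ) (act : ℕ → Set V) (S : ℕ → ℕ → Set V) (j : ℕ) (v : V) :
    Prop :=
  v ∈ act j ∧ ¬ IsVanillaRound G ε j ∧ 2 * ε * max 1 (nodeValue G ε act j v) <
    |estimate G ε C act (fun h => S h j) j v - nodeValue G ε act j v|

lemma nodeValue_active_succ_le (hε : 0 < ε) (hε1 : ε ≤ 1 / 1000) (j : ℕ) (v : V) :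
    nodeValue G ε (active G ε C S) (j + 1) v ≤ max 1 (nodeValue G ε (active G ε C S) j v) ∨
      Misjudged G ε C (active G ε C S) S j v := by
  set act := active G ε C S with hact
  have ha : IsShrinking act := isShrinking_active
  have h0 := nodeValue_nonneg (G := G) (act := act) hε j v
  have hs := nodeValue_succ_le (G := G) hε ha j v
  by_cases hv : v ∈ act (j + 1)
  swap
  · left; rw [nodeValue_succ_eq_of_notMem hv]; exact le_max_right _ _
  have hv' := hv
  rw [hact, active_succ, ← hact] at hv'
  obtain ⟨hvj, hfr⟩ := hv'
  by_cases hedge : ∃ x ∈ act j, ∃ y ∈ act j, G.Adj x y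
  swap
  · left
    refine le_trans (le_of_eq ?_) (le_max_right _ _)
    refine Finset.sum_congr rfl fun u hu => edgeValue_succ_of_not fun h => hedge ?_
    exact ⟨u, ha.anti j.le_succ h.1, v, hvj, by simpa [G.adj_comm] using hu⟩
  have hnf := hfr hedge
  unfold Freezes at hnf
  push Not at hnf
  obtain ⟨h1, h2⟩ := hnf
  by_cases hvan : IsVanillaRound G ε j
  · left
    have := h1 hvan
    refine le_trans ?_ (le_max_left _ _)
    nlinarith
  · have h3 := h2 hvan
    by_cases hm : Misjudged G ε C act S j v
    · exact Or.inr hm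
    left
    have h4 : |estimate G ε C act (fun h => S h j) j v - nodeValue G ε act j v| ≤
        2 * ε * max 1 (nodeValue G ε act j v) := by
      by_contra! hcon
      exact hm ⟨hvj, hvan, hcon⟩
    have h5 := (abs_le.1 h4).1
    refine le_trans ?_ (le_max_left _ _)
    rcases le_total (nodeValue G ε act j v) 1 with hc | hc
    · rw [max_eq_left hc] at h5
      nlinarith
    · rw [max_eq_right hc] at h5
      nlinarith

lemma nodeValue_active_le (hε : 0 < ε) (hε1 : ε ≤ 1 / 1000) (j : ℕ) (v : V) :
    nodeValue G ε (active G ε C S) j v ≤ 1 + ε * ∑ i ∈ Finset.range j,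
      if Misjudged G ε C (active G ε C S) S i v then
        max 1 (nodeValue G ε (active G ε C S) i v) else 0 := by
  have hterm : ∀ i, 0 ≤ (if Misjudged G ε C (active G ε C S) S i v then
      max 1 (nodeValue G ε (active G ε C S) i v) else 0) := fun i => by split_ifs <;> simp
  induction j with
  | zero => simpa using nodeValue_zero_le v
  | succ j ih =>
    rw [Finset.sum_range_succ]
    have hsum := Finset.sum_nonneg fun i (_ : i ∈ Finset.range j) => hterm i
    by_cases hm : Misjudged G ε C (active G ε C S) S j v
    · rw [if_pos hm]
      have h1 := nodeValue_succ_le (G := G) hε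
        (isShrinking_active (G := G) (ε := ε) (C := C) (S := S)) j v
      have h2 := le_max_right 1 (nodeValue G ε (active G ε C S) j v)
      nlinarith
    · rw [if_neg hm]
      have h1 := (nodeValue_active_succ_le hε hε1 j v).resolve_right hm
      rcases le_max_iff.1 h1 with h | h
      · nlinarith
      · linarith

lemma le_nodeValue_of_frozen (hε : 0 < ε) {f : ℕ} {v : V}
    (hv : v ∈ active G ε C S f) (hv' : v ∉ active G ε C S (f + 1))
    (hm : ¬ Misjudged G ε C (active G ε C S) S f v) :
    1 - 12 * ε ≤ nodeValue G ε (active G ε C S) f v := by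
  rw [active_succ] at hv'
  have hfr : Freezes G ε C (active G ε C S) (fun h => S h f) f v := by
    by_contra hcon
    exact hv' ⟨hv, fun _ => hcon⟩
  rcases hfr with ⟨-, h⟩ | ⟨hvan, h⟩
  · linarith
  · have h4 : |estimate G ε C (active G ε C S) (fun h => S h f) f v -
        nodeValue G ε (active G ε C S) f v| ≤
        2 * ε * max 1 (nodeValue G ε (active G ε C S) f v) := by
      by_contra! hcon
      exact hm ⟨hv, hvan, hcon⟩
    rcases le_total (nodeValue G ε (active G ε C S) f v) 1 with hc | hc
    · rw [max_eq_left hc] at h4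
      linarith [(abs_le.1 h4).2]
    · linarith

/-- The total value of the misjudged nodes in round `j`. -/
noncomputable def misjudgedValue (G : SimpleGraph V) (ε C : ℝ) (act : ℕ → Set V)
    (S : ℕ → ℕ → Set V) (j : ℕ) : ℝ :=
  ∑ v, if Misjudged G ε C act S j v then max 1 (nodeValue G ε act j v) else 0

lemma sum_nodeValue_cover_le (hε : 0 < ε) (hε1 : ε ≤ 1 / 1000) (D : Finset V) (j : ℕ) :
    ∑ v ∈ D, nodeValue G ε (active G ε C S) j v ≤
      D.card + ε * ∑ i ∈ Finset.range j, misjudgedValue G ε C (active G ε C S) S i := by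
  calc _ ≤ ∑ v ∈ D, (1 + ε * ∑ i ∈ Finset.range j,
      if Misjudged G ε C (active G ε C S) S i v then
        max 1 (nodeValue G ε (active G ε C S) i v) else 0) :=
        Finset.sum_le_sum fun v _ => nodeValue_active_le hε hε1 j v
    _ ≤ _ := by
      rw [Finset.sum_add_distrib, ← Finset.mul_sum, Finset.sum_comm]
      simp only [Finset.sum_const, nsmul_eq_mul, mul_one]
      gcongr with i
      exact Finset.sum_le_sum_of_subset_of_nonneg (Finset.subset_univ D)
        fun v _ _ => by split_ifs <;> simp

lemma misjudgedValue_eq_zero {act : ℕ → Set V} {j : ℕ} (h : IsVanillaRound G ε j) :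
    misjudgedValue G ε C act S j = 0 :=
  Finset.sum_eq_zero fun _ _ => if_neg fun hm => hm.2.1 h

lemma misjudgedValue_nonneg {act : ℕ → Set V} (j : ℕ) : 0 ≤ misjudgedValue G ε C act S j :=
  Finset.sum_nonneg fun v _ => by split_ifs <;> simp

lemma IsVanillaRound.mono {j k : ℕ} (hjk : j ≤ k) (h : IsVanillaRound G ε j) :
    IsVanillaRound G ε k :=
  let ⟨i, hi, h'⟩ := h
  ⟨i, hi.trans hjk, h'⟩

/-- If the misjudged nodes have a small total value, then few nodes are frozen. -/
lemma ncard_frozenSet_le (hε : 0 < ε) (hε1 : ε ≤ 1 / 1000) {D : Finset V}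
    (hD : G.IsVertexCover (D : Set V)) {J : ℕ} (hJ : IsVanillaRound G ε J)
    (hX : ∑ j ∈ Finset.range J, misjudgedValue G ε C (active G ε C S) S j ≤ ε * D.card) :
    ((frozenSet G ε C S).ncard : ℝ) ≤ (2 + 100 * ε) * D.card := by
  set act := active G ε C S with hact
  have ha : IsShrinking act := isShrinking_active
  set X := fun j => misjudgedValue G ε C act S j with hXdef
  have hsum : ∀ T, ∑ j ∈ Finset.range T, X j ≤ ε * D.card := by
    intro T
    refine le_trans ?_ hX
    rcases le_total T J with h | h
    · exact Finset.sum_le_sum_of_subset_of_nonneg (Finset.range_subset_range.2 h)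
        fun j _ _ => misjudgedValue_nonneg j
    · refine le_of_eq (Finset.sum_subset (Finset.range_subset_range.2 h) fun j _ hj => ?_).symm
      exact misjudgedValue_eq_zero (hJ.mono (by simpa using hj))
  have htime : ∀ v ∈ frozenSet G ε C S, ∃ f, v ∈ act f ∧ v ∉ act (f + 1) := by
    rintro v ⟨j, hj⟩
    have hex : ∃ j, v ∉ act j := ⟨j, hj⟩
    have hpos : Nat.find hex ≠ 0 := by
      intro h0
      have := Nat.find_spec hex
      rw [h0, ha.zero] at this
      exact this trivial
    refine ⟨Nat.find hex - 1, ?_, ?_⟩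
    · by_contra hcon
      have := Nat.find_min' hex hcon
      omega
    · rw [Nat.sub_add_cancel (Nat.one_le_iff_ne_zero.2 hpos)]
      exact Nat.find_spec hex
  choose! f hf1 hf2 using htime
  set T := (Finset.univ.sup f) + 1 with hT
  have hfT : ∀ v, f v < T := fun v => Nat.lt_succ_of_le (Finset.le_sup (Finset.mem_univ v))
  have hterm : ∀ i v, 0 ≤ (if Misjudged G ε C act S i v then
      max 1 (nodeValue G ε act i v) else 0) := fun i v => by split_ifs <;> simp
  have hone : ∀ v ∈ frozenSet G ε C S, (1 - 12 * ε) ≤ nodeValue G ε act T v +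
      ∑ i ∈ Finset.range T, if Misjudged G ε C act S i v then
        max 1 (nodeValue G ε act i v) else 0 := by
    intro v hv
    by_cases hm : Misjudged G ε C act S (f v) v
    · have h1 := Finset.single_le_sum (f := fun i => if Misjudged G ε C act S i v then
        max 1 (nodeValue G ε act i v) else 0) (fun i _ => hterm i v)
        (Finset.mem_range.2 (hfT v))
      simp only [if_pos hm] at h1
      have h2 := nodeValue_nonneg (G := G) (act := act) hε T v
      have h3 := le_max_left 1 (nodeValue G ε act (f v) v)
      linarith
    · have h1 := le_nodeValue_of_frozen hε (hf1 v hv) (hf2 v hv) hm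
      rw [nodeValue_eq_of_notMem ha (hfT v).le (hf2 v hv)]
      have := Finset.sum_nonneg fun i (_ : i ∈ Finset.range T) => hterm i v
      linarith
  have htotal : (1 - 12 * ε) * ((frozenSet G ε C S).ncard : ℝ) ≤
      ∑ v, nodeValue G ε act T v + ∑ i ∈ Finset.range T, X i := by
    rw [Set.ncard_eq_toFinset_card']
    calc (1 - 12 * ε) * ((frozenSet G ε C S).toFinset.card : ℝ)
        = ∑ v ∈ (frozenSet G ε C S).toFinset, (1 - 12 * ε) := by
          rw [Finset.sum_const, nsmul_eq_mul, mul_comm]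
      _ ≤ ∑ v ∈ (frozenSet G ε C S).toFinset, (nodeValue G ε act T v +
          ∑ i ∈ Finset.range T, if Misjudged G ε C act S i v then
            max 1 (nodeValue G ε act i v) else 0) :=
          Finset.sum_le_sum fun v hv => hone v (by simpa using hv)
      _ ≤ ∑ v, (nodeValue G ε act T v +
          ∑ i ∈ Finset.range T, if Misjudged G ε C act S i v then
            max 1 (nodeValue G ε act i v) else 0) :=
          Finset.sum_le_sum_of_subset_of_nonneg (Finset.subset_univ _) fun v _ _ =>
            add_nonneg (nodeValue_nonneg hε _ _) (Finset.sum_nonneg fun i _ => hterm i v)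
      _ = _ := by
          rw [Finset.sum_add_distrib, Finset.sum_comm]; rfl
  have h1 := sum_nodeValue_le (act := act) hε hD T
  have h2 := sum_nodeValue_cover_le (G := G) (C := C) (S := S) hε hε1 D T
  have h3 := hsum T
  have h2' : ∑ v ∈ D, nodeValue G ε act T v ≤ D.card + ε * (ε * D.card) :=
    h2.trans (by gcongr)
  have hDn : (0 : ℝ) ≤ D.card := by positivity
  have h4 : (1 - 12 * ε) * ((frozenSet G ε C S).ncard : ℝ) ≤
      (1 - 12 * ε) * ((2 + 100 * ε) * D.card) := by
    have : 2 + 2 * ε ^ 2 + ε ≤ (1 - 12 * ε) * (2 + 100 * ε) := by nlinarith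
    have := mul_le_mul_of_nonneg_right this hDn
    nlinarith
  exact le_of_mul_le_mul_left h4 (by linarith)

/-- Every edge has a frozen endpoint if there is a vanilla round. -/
lemma isVertexCover_frozenSet (hε : 0 < ε) (hvan : ∃ j, IsVanillaRound G ε j) :
    G.IsVertexCover (frozenSet G ε C S) := by
  intro u v huv
  by_contra! hcon
  obtain ⟨hu, hv⟩ := hcon
  simp only [frozenSet, Set.mem_ofPred_eq, not_exists, not_not] at hu hv
  have hdeg : 0 < G.maxDegree :=
    ((G.degree_pos_iff_exists_adj u).2 ⟨v, huv⟩).trans_le (G.degree_le_maxDegree u)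
  obtain ⟨j, hj⟩ := hvan
  obtain ⟨k, hk⟩ := pow_unbounded_of_one_lt (G.maxDegree : ℝ) (by linarith : 1 < 1 + ε)
  have hw : 1 ≤ weight G ε (max j k) := by
    refine le_trans ?_ (weight_mono hε (le_max_right j k))
    unfold weight
    rw [one_le_div (by exact_mod_cast hdeg)]
    exact hk.le
  have hmem := hu (max j k + 1)
  rw [active_succ] at hmem
  refine hmem.2 ⟨u, hu _, v, hv _, huv⟩ (Or.inl ⟨hj.mono (le_max_left j k), ?_⟩)
  have := weight_le_nodeValue (G := G) hε (le_refl (max j k)) huv (hv _) (hu _)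
  linarith

lemma frozenSet_eq_empty (hG : G = ⊥) : frozenSet G ε C S = ∅ := by
  have : ∀ j, active G ε C S j = Set.univ := by
    intro j
    induction j with
    | zero => exact isShrinking_active.zero
    | succ j ih =>
      rw [active_succ]
      ext v
      simp [nextActive, ih, show ∀ x y, ¬ G.Adj x y by simp [hG]]
  ext v; simp [frozenSet, this]

end Deterministic

section Phases

open scoped Classical

variable {V : Type*} [Fintype V] {G : SimpleGraph V} {ε C : ℝ}

lemma exists_iterate_log_le_one (x : ℝ) (hx : 1 < x) :
    ∃ m, 1 ≤ m ∧ Real.log^[m] x ≤ 1 ∧ ∀ i ≤ m, 0 < Real.log^[i] x := by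
  obtain ⟨k, hk⟩ := exists_nat_gt x
  induction k generalizing x with
  | zero => norm_num at hk; linarith
  | succ k ih =>
    have hlog := Real.log_pos hx
    rcases le_or_gt (Real.log x) 1 with h | h
    · refine ⟨1, le_rfl, h, fun i hi => ?_⟩
      interval_cases i
      · exact zero_lt_one.trans hx
      · exact hlog
    · have := Real.log_le_sub_one_of_pos (zero_lt_one.trans hx)
      push_cast at hk
      obtain ⟨m, -, h2, h3⟩ := ih (Real.log x) h (by linarith)
      refine ⟨m + 1, by omega, h2, fun i hi => ?_⟩
      rcases i with - | i
      · exact zero_lt_one.trans hx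
      · exact h3 i (by omega)

lemma iterLog_succ (n i : ℕ) : iterLog n (i + 1) = Real.log (iterLog n i) := by
  unfold iterLog; rw [Function.iterate_succ_apply']

lemma iterLog_one (n : ℕ) : iterLog n 1 = Real.log n := rfl

lemma iterLog_anti {n m : ℕ} (hpos : ∀ i ≤ m, 0 < iterLog n i) {i k : ℕ} (hik : i ≤ k)
    (hk : k ≤ m) : iterLog n k ≤ iterLog n i := by
  induction k, hik using Nat.le_induction with
  | base => exact le_rfl
  | succ k hik ih =>
    refine le_trans ?_ (ih (by omega))
    rw [iterLog_succ]
    linarith [Real.log_le_sub_one_of_pos (hpos k (by omega))]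

lemma two_le_card (hG : 0 < G.maxDegree) : 2 ≤ Fintype.card V := by
  have : Nonempty V := by
    by_contra h
    rw [not_nonempty_iff] at h
    simp at hG
  have := G.maxDegree_lt_card_verts
  omega

/-- The length of the descent of the iterated logarithm through positive values to at most `1`. -/
lemma exists_iterLog_le_one (hG : 0 < G.maxDegree) :
    ∃ m, 1 ≤ m ∧ iterLog (Fintype.card V) m ≤ 1 ∧ ∀ i ≤ m, 0 < iterLog (Fintype.card V) i :=
  exists_iterate_log_le_one _ (by exact_mod_cast two_le_card hG)

lemma phase_spec {m : ℕ} (hm : 1 ≤ m ∧ iterLog (Fintype.card V) m ≤ 1 ∧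
    ∀ i ≤ m, 0 < iterLog (Fintype.card V) i) {j : ℕ} (hw : weight G ε j ≤ 1) :
    1 ≤ phase G ε j ∧ phase G ε j ≤ m ∧
      weight G ε j ≤ 1 / iterLog (Fintype.card V) (phase G ε j) ^ 5 := by
  have hmem : m ∈ {i : ℕ | 1 ≤ i ∧ weight G ε j ≤ 1 / iterLog (Fintype.card V) i ^ 5} := by
    refine ⟨hm.1, hw.trans ?_⟩
    have h0 := hm.2.2 m le_rfl
    rw [one_le_div (by positivity)]
    exact pow_le_one₀ h0.le hm.2.1
  have h := Nat.sInf_mem ⟨m, hmem⟩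
  exact ⟨h.1, Nat.sInf_le hmem, h.2⟩

lemma phase_mono (hε : 0 < ε) {m : ℕ} (hm : 1 ≤ m ∧ iterLog (Fintype.card V) m ≤ 1 ∧
    ∀ i ≤ m, 0 < iterLog (Fintype.card V) i) {j k : ℕ} (hjk : j ≤ k) (hw : weight G ε k ≤ 1) :
    phase G ε j ≤ phase G ε k := by
  have h := phase_spec (G := G) hm hw
  exact Nat.sInf_le ⟨h.1, (weight_mono hε hjk).trans h.2.2⟩

lemma log_one_add_le (hε : 0 < ε) : Real.log (1 + ε) ≤ ε := by
  linarith [Real.log_le_sub_one_of_pos (by linarith : 0 < 1 + ε)]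

lemma half_le_log_one_add (hε : 0 < ε) (hε1 : ε ≤ 1 / 1000) : ε / 2 ≤ Real.log (1 + ε) := by
  refine le_trans ?_ (Real.one_sub_inv_le_log_of_pos (by linarith))
  have : 1 - (1 + ε)⁻¹ = ε / (1 + ε) := by field_simp; ring
  rw [this]
  gcongr
  linarith

lemma threshold_le (hε : 0 < ε) : ε * Real.log (1 + ε) / 1000 ≤ ε ^ 2 / 1000 := by
  have := log_one_add_le hε
  gcongr
  nlinarith

lemma weight_zero_le (hG : 0 < G.maxDegree) : weight G ε 0 ≤ 1 := by
  unfold weight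
  rw [pow_zero, div_le_one (by exact_mod_cast hG)]
  exact_mod_cast hG

/-- The vanilla part begins before the weights exceed `1`. -/
lemma isVanillaRound_of_one_lt_weight (hε : 0 < ε) (hε1 : ε ≤ 1 / 1000) (hG : 0 < G.maxDegree)
    {j : ℕ} (hj : 1 < weight G ε j) : IsVanillaRound G ε j := by
  obtain ⟨m, hm⟩ := exists_iterLog_le_one hG
  have hex : ∃ k, 1 < weight G ε k := ⟨j, hj⟩
  have hpos : Nat.find hex ≠ 0 := by
    intro h0
    have := Nat.find_spec hex
    rw [h0] at this
    exact absurd this (not_lt.2 (weight_zero_le hG))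
  obtain ⟨k, hk⟩ := Nat.exists_eq_succ_of_ne_zero hpos
  have hk1 : weight G ε k ≤ 1 := not_lt.1 (Nat.find_min hex (by omega))
  have hk2 : 1 < weight G ε (k + 1) := by
    have := Nat.find_spec hex
    rwa [hk] at this
  refine ⟨k, ?_, ?_⟩
  · have := Nat.find_min' hex hj
    omega
  · obtain ⟨-, h2, h3⟩ := phase_spec (G := G) hm hk1
    have hy := hm.2.2 _ h2
    set y := iterLog (Fintype.card V) (phase G ε k)
    rw [weight_succ] at hk2
    have hw : 1 / 2 < weight G ε k := by nlinarith
    have hy2 : y ≤ 2 := by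
      by_contra! hcon
      have h5 : (2 : ℝ) ^ 5 ≤ y ^ 5 := by gcongr
      have : 1 / y ^ 5 ≤ 1 / 2 ^ 5 := by gcongr
      have h32 : (1 : ℝ) / 2 ^ 5 ≤ 1 / 2 := by norm_num
      linarith
    have h6 : (1 : ℝ) / 2 ≤ 1 / y := by gcongr
    have := threshold_le hε
    nlinarith

lemma exists_isVanillaRound (hε : 0 < ε) (hε1 : ε ≤ 1 / 1000) (hG : 0 < G.maxDegree) :
    ∃ j, IsVanillaRound G ε j := by
  obtain ⟨k, hk⟩ := pow_unbounded_of_one_lt (G.maxDegree : ℝ) (by linarith : 1 < 1 + ε)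
  refine ⟨k, isVanillaRound_of_one_lt_weight hε hε1 hG ?_⟩
  unfold weight
  rw [one_lt_div (by exact_mod_cast hG)]
  exact hk

/-- The iterated logarithm that belongs to round `j`. -/
noncomputable def scale (G : SimpleGraph V) (ε : ℝ) (j : ℕ) : ℝ :=
  iterLog (Fintype.card V) (phase G ε j)

variable {j : ℕ}

lemma weight_le_one (hε : 0 < ε) (hε1 : ε ≤ 1 / 1000) (hG : 0 < G.maxDegree)
    (hj : ¬ IsVanillaRound G ε j) : weight G ε j ≤ 1 := by
  by_contra! h
  exact hj (isVanillaRound_of_one_lt_weight hε hε1 hG h)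

lemma le_scale (hε : 0 < ε) (hε1 : ε ≤ 1 / 1000) (hG : 0 < G.maxDegree)
    (hj : ¬ IsVanillaRound G ε j) : 1000 / ε ^ 2 ≤ scale G ε j := by
  obtain ⟨m, hm⟩ := exists_iterLog_le_one hG
  have hpos : 0 < scale G ε j := hm.2.2 _ (phase_spec hm (weight_le_one hε hε1 hG hj)).2.1
  have h : 1 / scale G ε j ≤ ε ^ 2 / 1000 := by
    by_contra! hcon
    exact hj ⟨j, le_rfl, (threshold_le hε).trans_lt hcon⟩
  rw [div_le_iff₀ (by positivity)]
  rw [div_le_iff₀ hpos] at h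
  linarith

lemma weight_le_scale (hε : 0 < ε) (hε1 : ε ≤ 1 / 1000) (hG : 0 < G.maxDegree)
    (hj : ¬ IsVanillaRound G ε j) : weight G ε j ≤ 1 / scale G ε j ^ 5 := by
  obtain ⟨m, hm⟩ := exists_iterLog_le_one hG
  exact (phase_spec hm (weight_le_one hε hε1 hG hj)).2.2

lemma inv_card_le_weight (hε : 0 < ε) (hG : 0 < G.maxDegree) :
    1 / (Fintype.card V : ℝ) ≤ weight G ε j := by
  refine le_trans ?_ (weight_mono hε (Nat.zero_le j))
  have h2 : Nonempty V := Fintype.card_pos_iff.1 (by have := two_le_card hG; omega)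
  unfold weight
  rw [pow_zero]
  have : (G.maxDegree : ℝ) ≤ Fintype.card V := by exact_mod_cast G.maxDegree_lt_card_verts.le
  have : (0 : ℝ) < G.maxDegree := by exact_mod_cast hG
  gcongr

lemma exp_le_weight (hε : 0 < ε) (hε1 : ε ≤ 1 / 1000) (hG : 0 < G.maxDegree)
    (hj : ¬ IsVanillaRound G ε j) : Real.exp (-(5 * scale G ε j)) ≤ weight G ε j := by
  obtain ⟨m, hm⟩ := exists_iterLog_le_one hG
  obtain ⟨h1, h2, -⟩ := phase_spec (G := G) hm (weight_le_one hε hε1 hG hj)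
  have hpos : 0 < scale G ε j := hm.2.2 _ h2
  obtain ⟨i, hi⟩ := Nat.exists_eq_add_of_le' h1
  have hy : 0 < iterLog (Fintype.card V) i := hm.2.2 i (by omega)
  have hexp : Real.exp (scale G ε j) = iterLog (Fintype.card V) i := by
    rw [scale, hi, iterLog_succ, Real.exp_log hy]
  have hexp5 : Real.exp (-(5 * scale G ε j)) = 1 / iterLog (Fintype.card V) i ^ 5 := by
    rw [Real.exp_neg, ← hexp, ← Real.exp_nat_mul]; norm_num
  rw [hexp5]
  rcases Nat.eq_zero_or_pos i with rfl | hi0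
  · refine le_trans ?_ (inv_card_le_weight hε hG)
    have h1n : (1 : ℝ) ≤ Fintype.card V := by exact_mod_cast (by have := two_le_card hG; omega)
    change 1 / (Fintype.card V : ℝ) ^ 5 ≤ _
    gcongr
    exact le_self_pow₀ h1n (by norm_num)
  · by_contra! hcon
    have : phase G ε j ≤ i := Nat.sInf_le ⟨hi0, hcon.le⟩
    omega

lemma scale_anti (hε : 0 < ε) (hε1 : ε ≤ 1 / 1000) (hG : 0 < G.maxDegree)
    (hj : ¬ IsVanillaRound G ε j) {h : ℕ} (hh : h ≤ j) : scale G ε j ≤ scale G ε h := by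
  obtain ⟨m, hm⟩ := exists_iterLog_le_one hG
  have hw := weight_le_one hε hε1 hG hj
  exact iterLog_anti hm.2.2 (phase_mono hε hm hh hw) (phase_spec hm hw).2.1

lemma scale_le_log (hε : 0 < ε) (hε1 : ε ≤ 1 / 1000) (hG : 0 < G.maxDegree)
    (hj : ¬ IsVanillaRound G ε j) : scale G ε j ≤ Real.log (Fintype.card V) := by
  obtain ⟨m, hm⟩ := exists_iterLog_le_one hG
  obtain ⟨h1, h2, -⟩ := phase_spec (G := G) hm (weight_le_one hε hε1 hG hj)
  exact iterLog_anti hm.2.2 h1 h2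

lemma scale_eq_log (hε : 0 < ε) (hε1 : ε ≤ 1 / 1000) (hG : 0 < G.maxDegree)
    (hj : ¬ IsVanillaRound G ε j) (hw : weight G ε j ≤ 1 / Real.log (Fintype.card V) ^ 5) :
    scale G ε j = Real.log (Fintype.card V) := by
  obtain ⟨m, hm⟩ := exists_iterLog_le_one hG
  obtain ⟨h1, -⟩ := phase_spec (G := G) hm (weight_le_one hε hε1 hG hj)
  have : phase G ε j ≤ 1 := Nat.sInf_le ⟨le_rfl, hw⟩
  rw [scale, le_antisymm this h1, iterLog_one]

lemma samplingProb_pos (hε : 0 < ε) (hε1 : ε ≤ 1 / 1000) (hG : 0 < G.maxDegree) (hC : 0 < C)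
    (hj : ¬ IsVanillaRound G ε j) : 0 < samplingProb G ε C j := by
  have h1 : 0 < scale G ε j := lt_of_lt_of_le (by positivity) (le_scale hε hε1 hG hj)
  rw [samplingProb, if_neg hj]
  exact lt_min one_pos (div_pos hC (pow_pos h1 4))

/-- A bound for the contribution of a single sampled node to an estimate. -/
lemma weight_div_samplingProb_le (hε : 0 < ε) (hε1 : ε ≤ 1 / 1000) (hG : 0 < G.maxDegree)
    (hC : 400 / ε ^ 2 ≤ C) (hj : ¬ IsVanillaRound G ε j) :
    weight G ε j / samplingProb G ε C j ≤ ε ^ 2 / (400 * scale G ε j) := by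
  have hL := le_scale hε hε1 hG hj
  have h1 : 0 < scale G ε j := lt_of_lt_of_le (by positivity) hL
  have hw := weight_le_scale hε hε1 hG hj
  have hC0 : 0 < C := lt_of_lt_of_le (by positivity) hC
  rw [div_le_iff₀ (by positivity)] at hL hC
  rw [div_le_iff₀ (samplingProb_pos hε hε1 hG hC0 hj), samplingProb, if_neg hj]
  refine hw.trans ?_
  change _ ≤ ε ^ 2 / (400 * scale G ε j) * min 1 (C / scale G ε j ^ 4)
  set L := scale G ε j
  rw [mul_min_of_nonneg _ _ (by positivity), le_min_iff]
  constructor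
  · rw [mul_one, div_le_div_iff₀ (by positivity) (by positivity)]
    have hε2 : ε ^ 2 ≤ 1 := by nlinarith
    have hL1 : 1 ≤ L := by nlinarith
    have h3 : L ^ 2 ≤ L ^ 5 := pow_le_pow_right₀ hL1 (by norm_num)
    have h4 : ε ^ 2 * L ^ 2 ≤ ε ^ 2 * L ^ 5 := by gcongr
    nlinarith
  · rw [div_mul_div_comm, div_le_div_iff₀ (by positivity) (by positivity)]
    have : 0 ≤ L ^ 5 := by positivity
    nlinarith

lemma round_mul_le (hε : 0 < ε) (hε1 : ε ≤ 1 / 1000) (hG : 0 < G.maxDegree)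
    (hj : ¬ IsVanillaRound G ε j) : ((j : ℝ) + 1) * ε ≤ 3 * Real.log (Fintype.card V) := by
  have hw := weight_le_one hε hε1 hG hj
  have hL := (le_scale hε hε1 hG hj).trans (scale_le_log hε hε1 hG hj)
  have h2 : Nonempty V := Fintype.card_pos_iff.1 (by have := two_le_card hG; omega)
  unfold weight at hw
  rw [div_le_one (by exact_mod_cast hG)] at hw
  have h3 : (1 + ε) ^ j ≤ (Fintype.card V : ℝ) :=
    hw.trans (by exact_mod_cast G.maxDegree_lt_card_verts.le)
  have h4 := Real.log_le_log (by positivity) h3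
  rw [Real.log_pow] at h4
  have h5 := half_le_log_one_add hε hε1
  have h6 : (j : ℝ) * (ε / 2) ≤ j * Real.log (1 + ε) := by gcongr
  rw [div_le_iff₀ (by positivity)] at hL
  have h7 : 1000 ≤ Real.log (Fintype.card V) := by
    have : ε ^ 2 ≤ 1 := by nlinarith
    by_contra! hcon
    nlinarith [Real.log_natCast_nonneg (Fintype.card V)]
  linarith

lemma sum_weight_sq_le (hε : 0 < ε) (hε1 : ε ≤ 1 / 1000) (hG : 0 < G.maxDegree)
    (hj : ¬ IsVanillaRound G ε j) :
    ∑ i ∈ Finset.range (j + 1), weight G ε i ^ 2 ≤ ε / 1000 := by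
  have hw := weight_le_one hε hε1 hG hj
  have hD : (0 : ℝ) < G.maxDegree := by exact_mod_cast hG
  have hL := le_scale hε hε1 hG hj
  have hL0 : 0 < scale G ε j := lt_of_lt_of_le (by positivity) hL
  have hsmall : weight G ε j ≤ ε ^ 2 / 1000 * (ε ^ 2 / 1000) := by
    refine (weight_le_scale hε hε1 hG hj).trans ?_
    have h1 : 1 / scale G ε j ≤ ε ^ 2 / 1000 := by
      rw [div_le_iff₀ hL0]
      rw [div_le_iff₀ (by positivity)] at hL
      linarith
    have h2 : 1 / scale G ε j ≤ 1 := h1.trans (by nlinarith)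
    have h0 : 0 < 1 / scale G ε j := by positivity
    calc 1 / scale G ε j ^ 5 = (1 / scale G ε j) ^ 5 := by rw [one_div_pow]
      _ ≤ (1 / scale G ε j) ^ 2 := pow_le_pow_of_le_one h0.le h2 (by norm_num)
      _ ≤ (ε ^ 2 / 1000) ^ 2 := by gcongr
      _ = _ := sq _
  have hgeom : ∑ i ∈ Finset.range (j + 1), weight G ε i ≤ 2 * weight G ε j / ε := by
    have h1 : ∀ i, weight G ε i = (1 + ε) ^ i * (1 / G.maxDegree) := fun i => by
      unfold weight; ring
    simp_rw [h1]
    rw [← Finset.sum_mul, geom_sum_eq (by linarith)]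
    rw [pow_succ]
    have : ((1 + ε) ^ j * (1 + ε) - 1) / (1 + ε - 1) ≤ 2 * (1 + ε) ^ j / ε := by
      rw [show 1 + ε - 1 = ε by ring]
      gcongr
      have : 0 < (1 + ε) ^ j := by positivity
      nlinarith
    refine (mul_le_mul_of_nonneg_right this (by positivity)).trans (le_of_eq (by ring))
  calc ∑ i ∈ Finset.range (j + 1), weight G ε i ^ 2
      ≤ ∑ i ∈ Finset.range (j + 1), weight G ε i * (ε ^ 2 / 1000) := by
        refine Finset.sum_le_sum fun i hi => ?_
        rw [sq]
        have h0 := weight_nonneg (G := G) hε i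
        have hij : weight G ε i ≤ weight G ε j :=
          weight_mono hε (Nat.lt_succ_iff.1 (Finset.mem_range.1 hi))
        refine mul_le_mul_of_nonneg_left (hij.trans (hsmall.trans ?_)) h0
        have : ε ^ 2 / 1000 ≤ 1 := by nlinarith
        nlinarith [sq_nonneg ε]
    _ ≤ 2 * weight G ε j / ε * (ε ^ 2 / 1000) := by
        rw [← Finset.sum_mul]; gcongr
    _ = weight G ε j * 2 * (ε / 1000) := by field_simp
    _ ≤ 1 * (ε / 1000) := by
        gcongr
        have h1 : ε ^ 2 / 1000 ≤ 1 / 2 := by nlinarith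
        nlinarith [sq_nonneg ε]
    _ = ε / 1000 := one_mul _

end Phases

section Sampling

open scoped Classical

variable {V : Type*} [Fintype V] {G : SimpleGraph V} {ε C : ℝ}

/-- The part of the estimate of `c_v` that comes from the rounds in `I`. -/
noncomputable def partialEstimate (G : SimpleGraph V) (ε C : ℝ) (a s : ℕ → Set V) (I : Finset ℕ)
    (v : V) : ℝ :=
  ∑ h ∈ I, ((s h ∩ a h ∩ G.neighborSet v).ncard : ℝ) / samplingProb G ε C h * weightIncr G ε h

/-- The part of `c_v` that comes from the rounds in `I`. -/
noncomputable def partialValue (G : SimpleGraph V) (ε : ℝ) (a : ℕ → Set V) (I : Finset ℕ)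
    (v : V) : ℝ :=
  ∑ h ∈ I, ((a h ∩ G.neighborSet v).ncard : ℝ) * weightIncr G ε h

/-- The part of the estimate that comes from the rounds in `I` is far from the truth. -/
def Deviates (G : SimpleGraph V) (ε C : ℝ) (a s : ℕ → Set V) (I : Finset ℕ) (j : ℕ) (v : V) :
    Prop :=
  ε * max 1 (nodeValue G ε a j v) < |partialEstimate G ε C a s I v - partialValue G ε a I v|

/-- The rounds up to `j` with a weight of at most `1 / (log n) ^ 5`. -/
noncomputable def fineRounds (G : SimpleGraph V) (ε : ℝ) (j : ℕ) : Finset ℕ :=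
  (Finset.range (j + 1)).filter fun h => weight G ε h ≤ 1 / Real.log (Fintype.card V) ^ 5

/-- The rounds up to `j` with a weight of more than `1 / (log n) ^ 5`. -/
noncomputable def coarseRounds (G : SimpleGraph V) (ε : ℝ) (j : ℕ) : Finset ℕ :=
  (Finset.range (j + 1)).filter fun h => ¬ weight G ε h ≤ 1 / Real.log (Fintype.card V) ^ 5

/-- The total value of the nodes that are misjudged because of the coarse rounds. -/
noncomputable def coarseValue (G : SimpleGraph V) (ε C : ℝ) (a s : ℕ → Set V) (j : ℕ) : ℝ :=
  ∑ v ∈ (a j).toFinset,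
    if Deviates G ε C a s (coarseRounds G ε j) j v then max 1 (nodeValue G ε a j v) else 0

/-- The sampled sets that are encoded by a set of triples. -/
def decode {V : Type*} (A : Set (ℕ × ℕ × V)) (h j : ℕ) : Set V := {v | (h, j, v) ∈ A}

/-- The event that a node is sampled. -/
def sampleEvent {V Ω : Type*} (S : Ω → ℕ → ℕ → Set V) (x : ℕ × ℕ × V) : Set Ω :=
  {ω | x.2.2 ∈ S ω x.1 x.2.1}

lemma decode_occurring {V Ω : Type*} {S : Ω → ℕ → ℕ → Set V} (ω : Ω) :
    decode (occurring (sampleEvent S) ω) = S ω := rfl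

/-- The triples that belong to the active neighbours of `v` in the rounds in `I`. -/
noncomputable def sampleIndices (G : SimpleGraph V) (a : ℕ → Set V) (I : Finset ℕ) (j : ℕ) (v : V) :
    Finset (ℕ × ℕ × V) :=
  (I ×ˢ ({j} : Finset ℕ) ×ˢ Finset.univ).filter fun x => x.2.2 ∈ a x.1 ∧ G.Adj v x.2.2

variable {a : ℕ → Set V} {I : Finset ℕ} {j : ℕ} {v : V}

lemma mem_sampleIndices {x : ℕ × ℕ × V} : x ∈ sampleIndices G a I j v ↔
    x.1 ∈ I ∧ x.2.1 = j ∧ x.2.2 ∈ a x.1 ∧ G.Adj v x.2.2 := by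
  simp only [sampleIndices, Finset.mem_filter, Finset.mem_product, Finset.mem_singleton,
    Finset.mem_univ, and_true, and_assoc]

lemma sum_sampleIndices (f : ℕ × ℕ × V → ℝ) :
    ∑ x ∈ sampleIndices G a I j v, f x =
      ∑ h ∈ I, ∑ u ∈ G.neighborFinset v, if u ∈ a h then f (h, j, u) else 0 := by
  rw [sampleIndices, Finset.sum_filter, Finset.sum_product]
  refine Finset.sum_congr rfl fun h _ => ?_
  rw [Finset.sum_product, Finset.sum_singleton, ← Finset.sum_subset (Finset.subset_univ
    (G.neighborFinset v)) (fun u _ hu => by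
      have : ¬ G.Adj v u := by simpa using hu
      simp [this])]
  refine Finset.sum_congr rfl fun u hu => ?_
  have : G.Adj v u := by simpa using hu
  simp [this]

lemma partialValue_eq_sum : partialValue G ε a I v =
    ∑ x ∈ sampleIndices G a I j v, weightIncr G ε x.1 := by
  rw [sum_sampleIndices]
  refine Finset.sum_congr rfl fun h _ => ?_
  rw [ncard_inter_neighborSet, Finset.sum_mul]
  exact Finset.sum_congr rfl fun u _ => by simp

lemma partialEstimate_eq_sum (A : Set (ℕ × ℕ × V)) :
    partialEstimate G ε C a (fun h => decode A h j) I v =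
      ∑ x ∈ sampleIndices G a I j v,
        if x ∈ A then weightIncr G ε x.1 / samplingProb G ε C x.1 else 0 := by
  rw [sum_sampleIndices]
  refine Finset.sum_congr rfl fun h _ => ?_
  rw [ncard_inter_neighborSet, div_mul_eq_mul_div, mul_div_assoc, Finset.sum_mul]
  refine Finset.sum_congr rfl fun u _ => ?_
  by_cases h1 : u ∈ a h <;> by_cases h2 : (h, j, u) ∈ A <;> simp [decode, h1, h2]

lemma dependsOnly_deviates : DependsOnly
    (fun A => Deviates G ε C a (fun h => decode A h j) I j v) (sampleIndices G a I j v) := by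
  intro A
  have h : partialEstimate G ε C a (fun h => decode A h j) I v =
      partialEstimate G ε C a (fun h => decode (A ∩ sampleIndices G a I j v) h j) I v := by
    rw [partialEstimate_eq_sum, partialEstimate_eq_sum]
    exact Finset.sum_congr rfl fun x hx => by simp [hx]
  simp only [Deviates, h]

lemma partialValue_le (hε : 0 < ε) (ha : IsShrinking a) (hv : v ∈ a j)
    (hI : I ⊆ Finset.range (j + 1)) : partialValue G ε a I v ≤ nodeValue G ε a j v := by
  rw [nodeValue_eq_sum ha hv]
  exact Finset.sum_le_sum_of_subset_of_nonneg hI fun h _ _ =>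
    mul_nonneg (Nat.cast_nonneg _) (weightIncr_nonneg hε h)

variable {Ω : Type*} {S : Ω → ℕ → ℕ → Set V} [MeasurableSpace Ω] {μ : Measure Ω}

lemma prob_deviates_le [IsProbabilityMeasure μ] (hS : IsSampling G ε C μ S) (hε : 0 < ε)
    (hε1 : ε ≤ 1 / 1000) (hG : 0 < G.maxDegree) (hC : 400 / ε ^ 2 ≤ C)
    (hj : ¬ IsVanillaRound G ε j) (ha : IsShrinking a) (hv : v ∈ a j)
    (hI : I ⊆ Finset.range (j + 1)) {L : ℝ} (hL : 0 < L)
    (hIL : ∀ h ∈ I, (∃ u ∈ a h, G.Adj v u) → L ≤ scale G ε h) :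
    μ.real {ω | Deviates G ε C a (fun h => S ω h j) I j v} ≤ 2 * Real.exp (-(100 * L)) := by
  have hC0 : 0 < C := lt_of_lt_of_le (by positivity) hC
  have hvan : ∀ h ∈ I, ¬ IsVanillaRound G ε h := fun h hh hv =>
    hj (hv.mono (Nat.lt_succ_iff.1 (Finset.mem_range.1 (hI hh))))
  have hp : ∀ x, μ.real (sampleEvent S x) = samplingProb G ε C x.1 :=
    fun x => hS.prob_mem x.1 x.2.1 x.2.2
  have key := prob_estimate_deviates (μ := μ) (E := sampleEvent S)
    (fun x => hS.measurableSet_mem x.1 x.2.1 x.2.2) hS.indep (sampleIndices G a I j v)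
    (fun x => weightIncr G ε x.1) (g := ε ^ 2 / (400 * L)) (M := max 1 (nodeValue G ε a j v))
    (ε := ε) (by positivity) hε (by linarith)
    (fun x hx => by
      rw [hp]
      exact samplingProb_pos hε hε1 hG hC0 (hvan _ (mem_sampleIndices.1 hx).1))
    (fun x hx => by
      obtain ⟨h1, -, h2, h3⟩ := mem_sampleIndices.1 hx
      have hLx := hIL _ h1 ⟨_, h2, h3⟩
      refine ⟨weightIncr_nonneg hε _, ?_⟩
      rw [hp]
      have h0 := samplingProb_pos hε hε1 hG hC0 (hvan _ h1)
      calc _ ≤ weight G ε x.1 / samplingProb G ε C x.1 := by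
            gcongr; exact weightIncr_le hε _
        _ ≤ ε ^ 2 / (400 * scale G ε x.1) := weight_div_samplingProb_le hε hε1 hG hC (hvan _ h1)
        _ ≤ _ := by gcongr)
    (by
      rw [← partialValue_eq_sum]
      exact (partialValue_le hε ha hv hI).trans (le_max_right _ _))
  refine le_trans (le_of_eq ?_) (key.trans ?_)
  · congr 1
    ext ω
    simp only [Deviates, Set.mem_ofPred_eq, ← decode_occurring (S := S) ω, partialEstimate_eq_sum,
      partialValue_eq_sum (j := j), hp]
  · gcongr
    have : ε ^ 2 * max 1 (nodeValue G ε a j v) / (4 * (ε ^ 2 / (400 * L))) =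
        100 * L * max 1 (nodeValue G ε a j v) := by field_simp; norm_num
    rw [this]
    have := le_max_left 1 (nodeValue G ε a j v)
    nlinarith

lemma not_deviates_of_forall_not_adj (hε : 0 < ε) {s : ℕ → Set V}
    (h : ∀ i ∈ I, ∀ u ∈ a i, ¬ G.Adj v u) : ¬ Deviates G ε C a s I j v := by
  have hempty : ∀ i ∈ I, a i ∩ G.neighborSet v = ∅ := fun i hi => by
    ext u
    simpa using h i hi u
  have h1 : partialValue G ε a I v = 0 :=
    Finset.sum_eq_zero fun i hi => by simp [hempty i hi]
  have h2 : partialEstimate G ε C a s I v = 0 :=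
    Finset.sum_eq_zero fun i hi => by simp [Set.inter_assoc, hempty i hi]
  rw [Deviates, h1, h2, sub_zero, abs_zero, not_lt]
  exact mul_nonneg hε.le (zero_le_one.trans (le_max_left _ _))

lemma two_mul_exp_le {L : ℝ} (hL : 1 ≤ L) :
    2 * Real.exp (-(100 * L)) ≤ Real.exp (-(5 * L)) ^ 3 := by
  have h1 : (2 : ℝ) ≤ Real.exp 1 := by linarith [Real.add_one_le_exp (1 : ℝ)]
  calc 2 * Real.exp (-(100 * L)) ≤ Real.exp 1 * Real.exp (-(100 * L)) := by gcongr
    _ = Real.exp (1 - 100 * L) := by rw [← Real.exp_add]; ring_nf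
    _ ≤ Real.exp (-(15 * L)) := Real.exp_le_exp.2 (by linarith)
    _ = _ := by rw [← Real.exp_nat_mul]; congr 1; push_cast; ring

lemma one_le_scale (hε : 0 < ε) (hε1 : ε ≤ 1 / 1000) (hG : 0 < G.maxDegree)
    (hj : ¬ IsVanillaRound G ε j) : 1 ≤ scale G ε j := by
  refine le_trans ?_ (le_scale hε hε1 hG hj)
  rw [le_div_iff₀ (by positivity)]
  nlinarith

lemma value_mul_prob_deviates_le [IsProbabilityMeasure μ] (hS : IsSampling G ε C μ S) (hε : 0 < ε)
    (hε1 : ε ≤ 1 / 1000) (hG : 0 < G.maxDegree) (hC : 400 / ε ^ 2 ≤ C)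
    (hj : ¬ IsVanillaRound G ε j) (ha : IsShrinking a) (hv : v ∈ a j)
    (hI : I ⊆ Finset.range (j + 1)) :
    max 1 (nodeValue G ε a j v) * μ.real {ω | Deviates G ε C a (fun h => S ω h j) I j v} ≤
      weight G ε j ^ 2 * nodeValue G ε a j v := by
  have hc0 := nodeValue_nonneg (G := G) (act := a) hε j v
  by_cases hex : ∃ h ∈ I, ∃ u ∈ a h, G.Adj v u
  swap
  · push Not at hex
    have : {ω | Deviates G ε C a (fun h => S ω h j) I j v} = ∅ := by
      ext ω; simpa using not_deviates_of_forall_not_adj hε hex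
    rw [this]
    simp only [measureReal_empty, mul_zero]
    positivity
  · have hne : (I.filter fun h => ∃ u ∈ a h, G.Adj v u).Nonempty := by
      obtain ⟨h, hh, hu⟩ := hex
      exact ⟨h, Finset.mem_filter.2 ⟨hh, hu⟩⟩
    set l := (I.filter fun h => ∃ u ∈ a h, G.Adj v u).max' hne with hl
    obtain ⟨hlI, u, hu, hvu⟩ := Finset.mem_filter.1 (Finset.max'_mem _ hne)
    rw [← hl] at hlI hu
    have hlj : l ≤ j := Nat.lt_succ_iff.1 (Finset.mem_range.1 (hI hlI))
    have hlv : ¬ IsVanillaRound G ε l := fun h => hj (h.mono hlj)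
    have hL1 := one_le_scale hε hε1 hG hlv
    have hP := prob_deviates_le hS hε hε1 hG hC hj ha hv hI (L := scale G ε l) (by linarith)
      (fun h hh hu => scale_anti hε hε1 hG hlv (Finset.le_max' _ _ (Finset.mem_filter.2 ⟨hh, hu⟩)))
    have hw0 := weight_pos (G := G) hε hG l
    have hw1 := weight_le_one hε hε1 hG hlv
    have hP3 : μ.real {ω | Deviates G ε C a (fun h => S ω h j) I j v} ≤ weight G ε l ^ 3 := by
      refine hP.trans ((two_mul_exp_le hL1).trans ?_)
      gcongr
      exact exp_le_weight hε hε1 hG hlv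
    have hcw := weight_le_nodeValue (G := G) hε hlj hvu hu (ha.anti hlj hv)
    have hM : max 1 (nodeValue G ε a j v) * weight G ε l ≤ nodeValue G ε a j v := by
      rw [max_mul_of_nonneg _ _ hw0.le, one_mul]
      exact max_le hcw (mul_le_of_le_one_right hc0 hw1)
    have hM0 : 0 ≤ max 1 (nodeValue G ε a j v) := zero_le_one.trans (le_max_left _ _)
    calc _ ≤ max 1 (nodeValue G ε a j v) * weight G ε l ^ 3 := by gcongr
      _ = weight G ε l ^ 2 * (max 1 (nodeValue G ε a j v) * weight G ε l) := by ring
      _ ≤ weight G ε l ^ 2 * nodeValue G ε a j v := by gcongr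
      _ ≤ _ := by
        gcongr
        exact weight_mono hε hlj

lemma fineRounds_subset : fineRounds G ε j ⊆ Finset.range (j + 1) := Finset.filter_subset _ _

lemma coarseRounds_subset : coarseRounds G ε j ⊆ Finset.range (j + 1) := Finset.filter_subset _ _

lemma prob_exists_deviates_fineRounds_le [IsProbabilityMeasure μ] (hS : IsSampling G ε C μ S)
    (hε : 0 < ε) (hε1 : ε ≤ 1 / 1000) (hG : 0 < G.maxDegree) (hC : 400 / ε ^ 2 ≤ C)
    (hj : ¬ IsVanillaRound G ε j) (ha : IsShrinking a) :
    μ.real {ω | ∃ v ∈ a j, Deviates G ε C a (fun h => S ω h j) (fineRounds G ε j) j v} ≤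
      Fintype.card V * (2 * Real.exp (-(100 * Real.log (Fintype.card V)))) := by
  have hlog : 0 < Real.log (Fintype.card V) :=
    Real.log_pos (by exact_mod_cast two_le_card hG)
  calc _ ≤ μ.real (⋃ v ∈ (a j).toFinset,
        {ω | Deviates G ε C a (fun h => S ω h j) (fineRounds G ε j) j v}) := by
        refine measureReal_mono (fun ω hω => ?_) (measure_ne_top _ _)
        obtain ⟨v, hv, hd⟩ := hω
        simp only [Set.mem_iUnion]
        exact ⟨v, by simpa using hv, hd⟩
    _ ≤ ∑ v ∈ (a j).toFinset, 2 * Real.exp (-(100 * Real.log (Fintype.card V))) := by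
        refine (measureReal_biUnion_finset_le _ _).trans (Finset.sum_le_sum fun v hv => ?_)
        refine prob_deviates_le hS hε hε1 hG hC hj ha (by simpa using hv) fineRounds_subset hlog ?_
        intro h hh _
        obtain ⟨h1, h2⟩ := Finset.mem_filter.1 hh
        exact (scale_eq_log hε hε1 hG
          (fun hvan => hj (hvan.mono (Nat.lt_succ_iff.1 (Finset.mem_range.1 h1)))) h2).ge
    _ ≤ _ := by
        rw [Finset.sum_const, nsmul_eq_mul]
        gcongr
        exact Finset.card_le_univ _

/-- All values are at most `1` until the first coarse round. -/
def BoundedUntilCoarse (G : SimpleGraph V) (ε : ℝ) (a : ℕ → Set V) (j : ℕ) : Prop :=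
  ∀ h ≤ j, (∀ i < h, weight G ε i ≤ 1 / Real.log (Fintype.card V) ^ 5) →
    ∀ v, nodeValue G ε a h v ≤ 1

lemma coarseRounds_eq_empty (hε : 0 < ε) (hw : weight G ε j ≤ 1 / Real.log (Fintype.card V) ^ 5) :
    coarseRounds G ε j = ∅ := by
  refine Finset.filter_eq_empty_iff.2 fun h hh => not_not.2 ?_
  exact (weight_mono hε (Nat.lt_succ_iff.1 (Finset.mem_range.1 hh))).trans hw

lemma coarseValue_eq_zero (hε : 0 < ε) {s : ℕ → Set V}
    (hw : weight G ε j ≤ 1 / Real.log (Fintype.card V) ^ 5) : coarseValue G ε C a s j = 0 := by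
  refine Finset.sum_eq_zero fun v _ => if_neg ?_
  rw [coarseRounds_eq_empty hε hw]
  exact not_deviates_of_forall_not_adj hε (by simp)

lemma card_conflicts_le (ha : IsShrinking a) {h d : ℕ} (hI : ∀ i ∈ I, h ≤ i)
    (hd : ∀ u ∈ a h, (a h ∩ G.neighborSet u).ncard ≤ d) (hhj : h ≤ j) (hv : v ∈ a j) :
    ((a j).toFinset.filter fun w => w ≠ v ∧
      ¬ Disjoint (sampleIndices G a I j v) (sampleIndices G a I j w)).card ≤ d * d := by
  have hsub : ((a j).toFinset.filter fun w => w ≠ v ∧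
      ¬ Disjoint (sampleIndices G a I j v) (sampleIndices G a I j w)) ⊆
      (a h ∩ G.neighborSet v).toFinset.biUnion fun u => (a h ∩ G.neighborSet u).toFinset := by
    intro w hw
    obtain ⟨hw1, -, hw2⟩ := Finset.mem_filter.1 hw
    obtain ⟨x, hx1, hx2⟩ := Finset.not_disjoint_iff.1 hw2
    rw [mem_sampleIndices] at hx1 hx2
    rw [Set.mem_toFinset] at hw1
    refine Finset.mem_biUnion.2 ⟨x.2.2, ?_, ?_⟩
    · rw [Set.mem_toFinset]
      exact ⟨ha.anti (hI _ hx1.1) hx1.2.2.1, hx1.2.2.2⟩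
    · rw [Set.mem_toFinset]
      exact ⟨ha.anti hhj hw1, hx2.2.2.2.symm⟩
  refine (Finset.card_le_card hsub).trans ((Finset.card_biUnion_le_card_mul _ _ d ?_).trans ?_)
  · intro u hu
    rw [Set.mem_toFinset] at hu
    rw [← Set.ncard_eq_toFinset_card']
    exact hd u hu.1
  · rw [← Set.ncard_eq_toFinset_card']
    exact Nat.mul_le_mul_right d (hd v (ha.anti hhj hv))

lemma exists_first_coarse (hε : 0 < ε) (hε1 : ε ≤ 1 / 1000) (hG : 0 < G.maxDegree)
    (hj : ¬ IsVanillaRound G ε j) (ha : IsShrinking a) (hb : BoundedUntilCoarse G ε a j) {Λ : ℝ}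
    (hΛ : Λ = Real.log (Fintype.card V)) (hΛ1 : 1 ≤ Λ) (hw : ¬ weight G ε j ≤ 1 / Λ ^ 5) :
    ∃ h ≤ j, (∀ i ∈ coarseRounds G ε j, h ≤ i) ∧
      (∀ u ∈ a h, (a h ∩ G.neighborSet u).ncard ≤ ⌊Λ ^ 5⌋₊) ∧
      ∀ v, max 1 (nodeValue G ε a j v) ≤ Λ ^ 5 := by
  have hex : ∃ h, ¬ weight G ε h ≤ 1 / Λ ^ 5 := ⟨j, hw⟩
  set h := Nat.find hex with hh
  have hh1 : ¬ weight G ε h ≤ 1 / Λ ^ 5 := Nat.find_spec hex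
  have hhj : h ≤ j := Nat.find_min' hex hw
  have hone : ∀ v, nodeValue G ε a h v ≤ 1 :=
    hb h hhj fun i hi => hΛ ▸ not_not.1 (Nat.find_min hex hi)
  have hI : ∀ i ∈ coarseRounds G ε j, h ≤ i := fun i hi =>
    Nat.find_min' hex (hΛ ▸ (Finset.mem_filter.1 hi).2)
  have hwh0 := weight_pos (G := G) hε hG h
  have hwh : 1 ≤ Λ ^ 5 * weight G ε h := by
    have := (not_le.1 hh1).le
    rwa [div_le_iff₀' (by positivity)] at this
  refine ⟨h, hhj, hI, fun u hu => Nat.le_floor ?_, fun v => max_le (one_le_pow₀ hΛ1) ?_⟩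
  · have h1 := (ncard_mul_weight_le_nodeValue (G := G) hε hu).trans (hone u)
    exact le_of_mul_le_mul_right (h1.trans hwh) hwh0
  · obtain ⟨k, hk⟩ := Nat.exists_eq_add_of_le hhj
    have h1 := nodeValue_add_le (G := G) hε ha h k v
    have h2 : (1 + ε) ^ k * nodeValue G ε a h v ≤ (1 + ε) ^ k :=
      mul_le_of_le_one_right (by positivity) (hone v)
    have h3 : weight G ε (h + k) = (1 + ε) ^ k * weight G ε h := by unfold weight; ring
    have h4 := weight_le_one hε hε1 hG hj
    rw [hk, h3] at h4
    rw [hk]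
    exact h1.trans (h2.trans (le_of_mul_le_mul_right (h4.trans hwh) hwh0))

lemma sum_value_mul_prob_deviates_le [IsProbabilityMeasure μ] (hS : IsSampling G ε C μ S)
    (hε : 0 < ε) (hε1 : ε ≤ 1 / 1000) (hG : 0 < G.maxDegree) (hC : 400 / ε ^ 2 ≤ C)
    (hj : ¬ IsVanillaRound G ε j) (ha : IsShrinking a) {N : ℝ}
    (hN : ∑ v, nodeValue G ε a j v ≤ 4 * N) :
    ∑ v ∈ (a j).toFinset, max 1 (nodeValue G ε a j v) *
      μ.real {ω | Deviates G ε C a (fun h => S ω h j) (coarseRounds G ε j) j v} ≤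
      weight G ε j ^ 2 * (4 * N) := by
  calc _ ≤ ∑ v ∈ (a j).toFinset, weight G ε j ^ 2 * nodeValue G ε a j v :=
        Finset.sum_le_sum fun v hv => value_mul_prob_deviates_le hS hε hε1 hG hC hj ha
          (by simpa using hv) coarseRounds_subset
    _ ≤ ∑ v, weight G ε j ^ 2 * nodeValue G ε a j v :=
        Finset.sum_le_sum_of_subset_of_nonneg (Finset.subset_univ _)
          fun v _ _ => mul_nonneg (sq_nonneg _) (nodeValue_nonneg hε j v)
    _ ≤ _ := by rw [← Finset.mul_sum]; gcongr

lemma prob_coarseValue_gt_le [IsProbabilityMeasure μ] (hS : IsSampling G ε C μ S)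
    (hε : 0 < ε) (hε1 : ε ≤ 1 / 1000) (hG : 0 < G.maxDegree) (hC : 400 / ε ^ 2 ≤ C)
    (hj : ¬ IsVanillaRound G ε j) (ha : IsShrinking a) (hb : BoundedUntilCoarse G ε a j) {N Λ : ℝ}
    (hΛ : Λ = Real.log (Fintype.card V))
    (hN : ∑ v, nodeValue G ε a j v ≤ 4 * N) (hN0 : 0 ≤ N) (hn : 2 * Λ ^ 10 ≤ Fintype.card V) :
    μ.real {ω | 8 * N * weight G ε j ^ 2 + 18 * Λ ^ 16 <
      coarseValue G ε C a (fun h => S ω h j) j} ≤ Real.exp (-(8 * Λ)) := by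
  have hcard : (0 : ℝ) < Fintype.card V := by
    exact_mod_cast (by have := two_le_card hG; omega : 0 < Fintype.card V)
  have hΛ1 : 1 ≤ Λ := hΛ ▸ (one_le_scale hε hε1 hG hj).trans (scale_le_log hε hε1 hG hj)
  have hΛ0 : 0 < Λ := by linarith
  by_cases hw : weight G ε j ≤ 1 / Λ ^ 5
  · have h0 : ∀ ω, coarseValue G ε C a (fun h => S ω h j) j = 0 :=
      fun ω => coarseValue_eq_zero hε (hΛ ▸ hw)
    have : {ω | 8 * N * weight G ε j ^ 2 + 18 * Λ ^ 16 <
        coarseValue G ε C a (fun h => S ω h j) j} = ∅ := by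
      refine Set.eq_empty_of_forall_notMem fun ω hω => ?_
      rw [Set.mem_ofPred_eq, h0 ω] at hω
      exact absurd hω (not_lt.2 (by positivity))
    rw [this, measureReal_empty]
    exact (Real.exp_pos _).le
  obtain ⟨h, hhj, hI, hdeg, hval⟩ := exists_first_coarse hε hε1 hG hj ha hb hΛ hΛ1 hw
  have hdΛ : (⌊Λ ^ 5⌋₊ : ℝ) ≤ Λ ^ 5 := Nat.floor_le (by positivity)
  generalize ⌊Λ ^ 5⌋₊ = d at hdeg hdΛ
  have key := prob_weighted_sum_ge_of_dependency (μ := μ) (E := sampleEvent S)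
    (fun x => hS.measurableSet_mem x.1 x.2.1 x.2.2) hS.indep (a j).toFinset
    (fun v A => Deviates G ε C a (fun h => decode A h j) (coarseRounds G ε j) j v)
    (fun v => sampleIndices G a (coarseRounds G ε j) j v)
    (fun v _ => dependsOnly_deviates) (d * d)
    (fun v hv => by convert card_conflicts_le ha hI hdeg hhj (Set.mem_toFinset.1 hv))
    (fun v => max 1 (nodeValue G ε a j v)) (B := Λ ^ 5) (by positivity)
    (fun v _ => ⟨zero_le_one.trans (le_max_left _ _), hval v⟩) (9 * Λ * Λ ^ 5)
  simp only [decode_occurring] at key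
  have hE := sum_value_mul_prob_deviates_le hS hε hε1 hG hC hj ha hN
  have hdd : ((d * d : ℕ) : ℝ) + 1 ≤ 2 * Λ ^ 10 := by
    push_cast
    have h1 : (d : ℝ) * d ≤ Λ ^ 5 * Λ ^ 5 := by gcongr
    have h2 : 1 ≤ Λ ^ 10 := one_le_pow₀ hΛ1
    have h3 : Λ ^ 5 * Λ ^ 5 = Λ ^ 10 := by ring
    linarith
  have hs : (((d * d : ℕ) : ℝ) + 1) * (9 * Λ * Λ ^ 5) ≤ 18 * Λ ^ 16 :=
    (mul_le_mul_of_nonneg_right hdd (by positivity)).trans (le_of_eq (by ring))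
  have hdiv : 9 * Λ * Λ ^ 5 / Λ ^ 5 = 9 * Λ := by field_simp
  rw [hdiv] at key
  have hsub : ∀ x, 8 * N * weight G ε j ^ 2 + 18 * Λ ^ 16 < x →
      2 * ∑ v ∈ (a j).toFinset, max 1 (nodeValue G ε a j v) *
        μ.real {ω | Deviates G ε C a (fun h => S ω h j) (coarseRounds G ε j) j v} +
        (((d * d : ℕ) : ℝ) + 1) * (9 * Λ * Λ ^ 5) < x := fun x hx => by linarith
  refine (measureReal_mono (fun ω hω => hsub _ hω) (measure_ne_top _ _)).trans (key.trans ?_)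
  calc _ ≤ Fintype.card V * Real.exp (-(9 * Λ)) :=
          mul_le_mul_of_nonneg_right (hdd.trans hn) (Real.exp_pos _).le
      _ = Real.exp Λ * Real.exp (-(9 * Λ)) := by rw [hΛ, Real.exp_log hcard]
      _ = _ := by rw [← Real.exp_add]; congr 1; ring

end Sampling

section Approximation

open scoped Classical

variable {V : Type*} [Fintype V] {G : SimpleGraph V} {ε C : ℝ} {a a' s s' : ℕ → Set V}
  {I : Finset ℕ} {j : ℕ} {v : V}

lemma deviates_congr (ha : ∀ i ≤ j, a i = a' i) (hs : ∀ i ≤ j, s i = s' i)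
    (hI : I ⊆ Finset.range (j + 1)) :
    Deviates G ε C a s I j v ↔ Deviates G ε C a' s' I j v := by
  have hle : ∀ i ∈ I, i ≤ j := fun i hi => Nat.lt_succ_iff.1 (Finset.mem_range.1 (hI hi))
  have h1 : partialEstimate G ε C a s I v = partialEstimate G ε C a' s' I v :=
    Finset.sum_congr rfl fun i hi => by rw [ha i (hle i hi), hs i (hle i hi)]
  have h2 : partialValue G ε a I v = partialValue G ε a' I v :=
    Finset.sum_congr rfl fun i hi => by rw [ha i (hle i hi)]
  rw [Deviates, Deviates, h1, h2, nodeValue_congr ha]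

lemma coarseValue_congr (ha : ∀ i ≤ j, a i = a' i) (hs : ∀ i ≤ j, s i = s' i) :
    coarseValue G ε C a s j = coarseValue G ε C a' s' j := by
  unfold coarseValue
  simp only [ha j le_rfl, nodeValue_congr ha, deviates_congr ha hs coarseRounds_subset]

lemma deviates_of_misjudged {S : ℕ → ℕ → Set V} (ha : IsShrinking a)
    (h : Misjudged G ε C a S j v) :
    Deviates G ε C a (fun h => S h j) (fineRounds G ε j) j v ∨
      Deviates G ε C a (fun h => S h j) (coarseRounds G ε j) j v := by
  obtain ⟨hv, -, hdev⟩ := h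
  by_contra! hcon
  obtain ⟨h1, h2⟩ := hcon
  rw [Deviates, not_lt] at h1 h2
  have he : estimate G ε C a (fun h => S h j) j v =
      partialEstimate G ε C a (fun h => S h j) (fineRounds G ε j) v +
        partialEstimate G ε C a (fun h => S h j) (coarseRounds G ε j) v :=
    (Finset.sum_filter_add_sum_filter_not _ _ _).symm
  have hc : nodeValue G ε a j v =
      partialValue G ε a (fineRounds G ε j) v + partialValue G ε a (coarseRounds G ε j) v := by
    rw [nodeValue_eq_sum ha hv]
    exact (Finset.sum_filter_add_sum_filter_not _ _ _).symm
  have hsum := (abs_add_le _ _).trans (add_le_add h1 h2)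
  rw [show ∀ x y z w : ℝ, x - y + (z - w) = x + z - (y + w) by intros; ring, ← he, ← hc] at hsum
  linarith

lemma misjudgedValue_le_coarseValue {S : ℕ → ℕ → Set V} (ha : IsShrinking a)
    (hfine : ∀ v ∈ a j, ¬ Deviates G ε C a (fun h => S h j) (fineRounds G ε j) j v) :
    misjudgedValue G ε C a S j ≤ coarseValue G ε C a (fun h => S h j) j := by
  rw [misjudgedValue, coarseValue,
    ← Finset.sum_subset (Finset.subset_univ (a j).toFinset) fun v _ hv =>
      if_neg fun hm => hv (Set.mem_toFinset.2 hm.1)]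
  refine Finset.sum_le_sum fun v hv => ?_
  by_cases hm : Misjudged G ε C a S j v
  · rw [if_pos hm, if_pos ((deviates_of_misjudged ha hm).resolve_left
      (hfine v (Set.mem_toFinset.1 hv)))]
  · rw [if_neg hm]
    split_ifs <;> simp

lemma le_log_card (hε : 0 < ε) (hε1 : ε ≤ 1 / 1000) (hG : 0 < G.maxDegree)
    (hj : ¬ IsVanillaRound G ε j) : 1000 ≤ ε ^ 2 * Real.log (Fintype.card V) := by
  have hL := (le_scale hε hε1 hG hj).trans (scale_le_log hε hε1 hG hj)
  rwa [div_le_iff₀' (by positivity)] at hL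

lemma sum_threshold_le (hε : 0 < ε) (hε1 : ε ≤ 1 / 1000) (hG : 0 < G.maxDegree)
    (hj : ¬ IsVanillaRound G ε j) {N Λ : ℝ} (hΛ : Λ = Real.log (Fintype.card V))
    (hN : Λ ^ 18 ≤ N) :
    ∑ i ∈ Finset.range (j + 1), (8 * N * weight G ε i ^ 2 + 18 * Λ ^ 16) ≤ ε * N := by
  have h1 := sum_weight_sq_le hε hε1 hG hj
  have h2 := round_mul_le hε hε1 hG hj
  have h3 := le_log_card hε hε1 hG hj
  rw [← hΛ] at h2 h3
  have hΛ0 : 0 < Λ := by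
    by_contra! h
    nlinarith [sq_nonneg ε]
  have hN0 : 0 ≤ N := le_trans (by positivity) hN
  rw [Finset.sum_add_distrib, ← Finset.mul_sum, Finset.sum_const, Finset.card_range, nsmul_eq_mul]
  have h4 : ((j + 1 : ℕ) : ℝ) * (18 * Λ ^ 16) ≤ ε * N / 2 := by
    push_cast
    have h5 : ((j : ℝ) + 1) * 1000 ≤ 3 * ε * Λ ^ 2 := by
      have h6 : ((j : ℝ) + 1) * 1000 ≤ ((j : ℝ) + 1) * (ε ^ 2 * Λ) := by gcongr
      have h7 : ((j : ℝ) + 1) * ε * (ε * Λ) ≤ 3 * Λ * (ε * Λ) := by gcongr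
      linarith
    have h8 : ((j : ℝ) + 1) * 1000 * Λ ^ 16 ≤ 3 * ε * Λ ^ 2 * Λ ^ 16 := by gcongr
    have h9 : ε * Λ ^ 18 ≤ ε * N := by gcongr
    have h10 : 3 * ε * Λ ^ 2 * Λ ^ 16 = 3 * (ε * Λ ^ 18) := by ring
    have h11 : 0 ≤ ε * N := by positivity
    nlinarith
  have h5 : 8 * N * ∑ i ∈ Finset.range (j + 1), weight G ε i ^ 2 ≤ 8 * N * (ε / 1000) := by gcongr
  have h6 : 0 ≤ ε * N := by positivity
  linarith

lemma misjudgedValue_le {S : ℕ → ℕ → Set V} (hε : 0 < ε) (hε1 : ε ≤ 1 / 1000)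
    (hG : 0 < G.maxDegree) {D : Finset V} (hD : G.IsVertexCover (D : Set V)) {Λ : ℝ}
    (hΛ : Λ = Real.log (Fintype.card V)) (hN : Λ ^ 18 ≤ D.card)
    (hfine : ∀ i, ¬ IsVanillaRound G ε i → ∀ v ∈ active G ε C S i,
      ¬ Deviates G ε C (active G ε C S) (fun h => S h i) (fineRounds G ε i) i v)
    (hcoarse : ∀ i, ¬ IsVanillaRound G ε i → BoundedUntilCoarse G ε (active G ε C S) i →
      ∑ v, nodeValue G ε (active G ε C S) i v ≤ 4 * D.card →
      coarseValue G ε C (active G ε C S) (fun h => S h i) i ≤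
        8 * D.card * weight G ε i ^ 2 + 18 * Λ ^ 16)
    (j : ℕ) (hj : ¬ IsVanillaRound G ε j) :
    misjudgedValue G ε C (active G ε C S) S j ≤ 8 * D.card * weight G ε j ^ 2 + 18 * Λ ^ 16 := by
  induction j using Nat.strong_induction_on with
  | _ j ih =>
    have ha : IsShrinking (active G ε C S) := isShrinking_active
    have hvan : ∀ i ≤ j, ¬ IsVanillaRound G ε i := fun i hi h => hj (h.mono hi)
    refine (misjudgedValue_le_coarseValue ha (hfine j hj)).trans (hcoarse j hj ?_ ?_)
    · intro h hhj hfirst v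
      refine (nodeValue_active_le hε hε1 h v).trans (le_of_eq ?_)
      rw [Finset.sum_eq_zero, mul_zero, add_zero]
      intro i hi
      have hih := Finset.mem_range.1 hi
      refine if_neg fun hm => ?_
      rcases deviates_of_misjudged ha hm with hd | hd
      · exact hfine i (hvan i (by omega)) v hm.1 hd
      · rw [coarseRounds_eq_empty hε (hfirst i hih)] at hd
        exact not_deviates_of_forall_not_adj hε (by simp) hd
    · have h1 := sum_nodeValue_le (act := active G ε C S) hε hD j
      have h2 := sum_nodeValue_cover_le (C := C) (S := S) (G := G) hε hε1 D j
      have h3 : ∑ i ∈ Finset.range j, misjudgedValue G ε C (active G ε C S) S i ≤ ε * D.card := by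
        refine le_trans ?_ (sum_threshold_le hε hε1 hG hj hΛ hN)
        calc _ ≤ ∑ i ∈ Finset.range j, (8 * D.card * weight G ε i ^ 2 + 18 * Λ ^ 16) :=
              Finset.sum_le_sum fun i hi =>
                ih i (Finset.mem_range.1 hi) (hvan i (Finset.mem_range.1 hi).le)
          _ ≤ _ := Finset.sum_le_sum_of_subset_of_nonneg
              (Finset.range_subset_range.2 j.le_succ) fun i _ _ => by positivity
      have h4 : ε * ∑ i ∈ Finset.range j, misjudgedValue G ε C (active G ε C S) S i ≤
          ε * (ε * D.card) := by gcongr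
      have h5 : ε * (ε * D.card) ≤ 1 * (1 * (D.card : ℝ)) := by gcongr <;> linarith
      linarith

lemma dependsOnly_history (j : ℕ) : DependsOnly
    (fun A : Set (ℕ × ℕ × V) => history G ε C (decode A) j)
    (Finset.range j ×ˢ Finset.range j ×ˢ Finset.univ) := by
  intro A
  refine history_congr j fun i hi l hl => ?_
  ext v
  simp [decode, hi, hl.trans_lt hi]

lemma decode_inter_eq (A : Set (ℕ × ℕ × V)) {i : ℕ} (hi : i ≤ j) :
    decode (A ∩ ((Finset.range (j + 1) ×ˢ {j} ×ˢ Finset.univ : Finset (ℕ × ℕ × V)) :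
      Set (ℕ × ℕ × V))) i j = decode A i j := by
  ext v
  simp [decode, Nat.lt_succ_of_le hi]

lemma disjoint_past_present (j : ℕ) : Disjoint
    (Finset.range j ×ˢ Finset.range j ×ˢ Finset.univ : Finset (ℕ × ℕ × V))
    (Finset.range (j + 1) ×ˢ {j} ×ˢ Finset.univ) := by
  rw [Finset.disjoint_left]
  intro x h1 h2
  simp only [Finset.mem_product, Finset.mem_range, Finset.mem_singleton] at h1 h2
  omega

variable {Ω : Type*} [MeasurableSpace Ω] {μ : Measure Ω} {S : Ω → ℕ → ℕ → Set V}

lemma history_eq_of_le {S : ℕ → ℕ → Set V} (i : ℕ) (hi : i ≤ j) :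
    history G ε C S j i = active G ε C S i := by
  rw [history_eq_active, min_eq_left hi]

lemma prob_fine_failure_le [IsProbabilityMeasure μ] (hS : IsSampling G ε C μ S)
    (hε : 0 < ε) (hε1 : ε ≤ 1 / 1000) (hG : 0 < G.maxDegree) (hC : 400 / ε ^ 2 ≤ C)
    (hj : ¬ IsVanillaRound G ε j) :
    μ.real {ω | ∃ v ∈ active G ε C (S ω) j, Deviates G ε C (active G ε C (S ω))
        (fun h => S ω h j) (fineRounds G ε j) j v} ≤
      Fintype.card V * (2 * Real.exp (-(100 * Real.log (Fintype.card V)))) := by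
  have key := prob_le_of_past (μ := μ) (E := sampleEvent S)
    (fun x => hS.measurableSet_mem x.1 x.2.1 x.2.2) hS.indep
    (dependsOnly_history (G := G) (ε := ε) (C := C) j) (disjoint_past_present j) (fun _ => True)
    (fun b A => ∃ v ∈ b j, Deviates G ε C b (fun h => decode A h j) (fineRounds G ε j) j v)
    (fun b A => by
      simp only [deviates_congr (a := b) (fun _ _ => rfl)
        (fun i hi => (decode_inter_eq A hi).symm) fineRounds_subset])
    _ (fun A _ => prob_exists_deviates_fineRounds_le hS hε hε1 hG hC hj (isShrinking_history j))
    (by positivity)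
  refine (measureReal_mono (fun ω hω => ?_) (measure_ne_top _ _)).trans key
  obtain ⟨v, hv, hd⟩ := hω
  refine ⟨trivial, v, ?_, ?_⟩
  · rw [history_eq_of_le j le_rfl]; exact hv
  · exact (deviates_congr (fun i hi => (history_eq_of_le i hi).symm) (fun _ _ => rfl)
      fineRounds_subset).1 hd

lemma boundedUntilCoarse_congr (h : ∀ i ≤ j, a i = a' i) (hb : BoundedUntilCoarse G ε a j) :
    BoundedUntilCoarse G ε a' j := fun i hi hw v => by
  rw [← nodeValue_congr fun k hk => h k (hk.trans hi)]
  exact hb i hi hw v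

lemma prob_coarse_failure_le [IsProbabilityMeasure μ] (hS : IsSampling G ε C μ S)
    (hε : 0 < ε) (hε1 : ε ≤ 1 / 1000) (hG : 0 < G.maxDegree) (hC : 400 / ε ^ 2 ≤ C)
    (hj : ¬ IsVanillaRound G ε j) {N Λ : ℝ} (hΛ : Λ = Real.log (Fintype.card V)) (hN0 : 0 ≤ N)
    (hn : 2 * Λ ^ 10 ≤ Fintype.card V) :
    μ.real {ω | (BoundedUntilCoarse G ε (active G ε C (S ω)) j ∧
        ∑ v, nodeValue G ε (active G ε C (S ω)) j v ≤ 4 * N) ∧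
        8 * N * weight G ε j ^ 2 + 18 * Λ ^ 16 <
          coarseValue G ε C (active G ε C (S ω)) (fun h => S ω h j) j} ≤
      Real.exp (-(8 * Λ)) := by
  have key := prob_le_of_past (μ := μ) (E := sampleEvent S)
    (fun x => hS.measurableSet_mem x.1 x.2.1 x.2.2) hS.indep
    (dependsOnly_history (G := G) (ε := ε) (C := C) j) (disjoint_past_present j)
    (fun b => BoundedUntilCoarse G ε b j ∧ ∑ v, nodeValue G ε b j v ≤ 4 * N)
    (fun b A => 8 * N * weight G ε j ^ 2 + 18 * Λ ^ 16 <
      coarseValue G ε C b (fun h => decode A h j) j)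
    (fun b A => by
      simp only [coarseValue_congr (a := b) (fun _ _ => rfl)
        (fun i hi => (decode_inter_eq A hi).symm)])
    _ (fun A hA => prob_coarseValue_gt_le hS hε hε1 hG hC hj (isShrinking_history j) hA.1 hΛ hA.2
      hN0 hn)
    (Real.exp_pos _).le
  refine (measureReal_mono (fun ω hω => ?_) (measure_ne_top _ _)).trans key
  obtain ⟨⟨h1, h2⟩, h3⟩ := hω
  have hh : ∀ i ≤ j, active G ε C (S ω) i = history G ε C (S ω) j i :=
    fun i hi => (history_eq_of_le i hi).symm
  refine ⟨⟨boundedUntilCoarse_congr hh h1, ?_⟩, ?_⟩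
  · exact (Finset.sum_congr rfl fun v _ => (nodeValue_congr hh v).symm).trans_le h2
  · rw [coarseValue_congr hh fun _ _ => rfl] at h3
    exact h3

lemma failure_sum_le {n Λ J : ℝ} (hn : n = Real.exp Λ) (hΛ1 : 1 ≤ Λ) (hJ0 : 0 ≤ J)
    (hJ : 4 * J ≤ n) :
    J * (n * (2 * Real.exp (-(100 * Λ))) + Real.exp (-(8 * Λ))) ≤ 1 / n ^ 6 := by
  have h1 : n * (2 * Real.exp (-(100 * Λ))) ≤ Real.exp (-(8 * Λ)) := by
    have h2 : (2 : ℝ) ≤ Real.exp 1 := by linarith [Real.add_one_le_exp (1 : ℝ)]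
    calc n * (2 * Real.exp (-(100 * Λ))) ≤ Real.exp Λ * (Real.exp 1 * Real.exp (-(100 * Λ))) := by
          rw [hn]; gcongr
      _ = Real.exp (Λ + (1 + -(100 * Λ))) := by rw [Real.exp_add, Real.exp_add]
      _ ≤ _ := Real.exp_le_exp.2 (by linarith)
  have h6 : 1 / n ^ 6 = n * (n * Real.exp (-(8 * Λ))) := by
    rw [hn, ← Real.exp_nat_mul, one_div, ← Real.exp_neg, ← Real.exp_add, ← Real.exp_add]
    congr 1; push_cast; ring
  have hn1 : 1 ≤ n := by rw [hn]; exact Real.one_le_exp (by linarith)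
  have he := Real.exp_pos (-(8 * Λ))
  rw [h6]
  calc _ ≤ J * (2 * Real.exp (-(8 * Λ))) := by gcongr; linarith
    _ ≤ n * Real.exp (-(8 * Λ)) := by nlinarith
    _ ≤ _ := le_mul_of_one_le_left (by positivity) hn1

lemma prob_approximation [IsProbabilityMeasure μ] (hS : IsSampling G ε C μ S)
    (hε : 0 < ε) (hε1 : ε ≤ 1 / 1000) (hG : 0 < G.maxDegree) (hC : 400 / ε ^ 2 ≤ C)
    {D : Finset V} (hD : G.IsVertexCover (D : Set V))
    (hN : Real.log (Fintype.card V) ^ 18 ≤ D.card) :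
    1 - 1 / (Fintype.card V : ℝ) ^ 6 ≤
      μ.real {ω | G.IsVertexCover (frozenSet G ε C (S ω)) ∧
        ((frozenSet G ε C (S ω)).ncard : ℝ) ≤ (2 + 100 * ε) * D.card} := by
  set good := {ω | G.IsVertexCover (frozenSet G ε C (S ω)) ∧
        ((frozenSet G ε C (S ω)).ncard : ℝ) ≤ (2 + 100 * ε) * D.card} with hgood
  set n : ℝ := (Fintype.card V : ℝ) with hn
  obtain ⟨Λ, hΛ⟩ : ∃ Λ, Λ = Real.log n := ⟨_, rfl⟩
  rw [← hΛ] at hN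
  have hn2 : (2 : ℝ) ≤ n := by rw [hn]; exact_mod_cast two_le_card hG
  have hex := exists_isVanillaRound (G := G) hε hε1 hG
  set J := Nat.find hex with hJ
  have hJvan : IsVanillaRound G ε J := Nat.find_spec hex
  have hlt : ∀ i, ¬ IsVanillaRound G ε i → i < J := fun i hi => by
    by_contra! h
    exact hi (hJvan.mono h)
  have hcover := fun ω => isVertexCover_frozenSet (C := C) (S := S ω) hε hex
  let F1 : ℕ → Set Ω := fun j => {ω | ∃ v ∈ active G ε C (S ω) j,
    Deviates G ε C (active G ε C (S ω)) (fun h => S ω h j) (fineRounds G ε j) j v}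
  let F2 : ℕ → Set Ω := fun j => {ω | (BoundedUntilCoarse G ε (active G ε C (S ω)) j ∧
        ∑ v, nodeValue G ε (active G ε C (S ω)) j v ≤ 4 * D.card) ∧
        8 * D.card * weight G ε j ^ 2 + 18 * Λ ^ 16 <
          coarseValue G ε C (active G ε C (S ω)) (fun h => S ω h j) j}
  have hbad : goodᶜ ⊆ ⋃ j ∈ Finset.range J, (F1 j ∪ F2 j) := by
    intro ω hω
    by_contra hcon
    simp only [Set.mem_iUnion, Finset.mem_range, not_exists, Set.mem_union, not_or] at hcon
    refine hω ⟨hcover ω, ncard_frozenSet_le hε hε1 hD hJvan ?_⟩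
    have hle := misjudgedValue_le (C := C) (S := S ω) hε hε1 hG hD hΛ hN
      (fun i hi v hv hd => (hcon i (hlt i hi)).1 ⟨v, hv, hd⟩)
      (fun i hi hb hs => by
        by_contra! hgt
        exact (hcon i (hlt i hi)).2 ⟨⟨hb, hs⟩, hgt⟩)
    have hmin : ∀ i < J, ¬ IsVanillaRound G ε i := fun i hi => Nat.find_min hex hi
    clear_value J
    rcases J with - | j
    · simp only [Finset.range_zero, Finset.sum_empty]; positivity
    · exact (Finset.sum_le_sum fun i hi => hle i (hmin i (Finset.mem_range.1 hi))).trans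
        (sum_threshold_le hε hε1 hG (hmin j j.lt_succ_self) hΛ hN)
  have hbound : μ.real goodᶜ ≤ 1 / n ^ 6 := by
    refine (measureReal_mono hbad (measure_ne_top _ _)).trans ?_
    have hmin : ∀ i < J, ¬ IsVanillaRound G ε i := fun i hi => Nat.find_min hex hi
    clear_value J
    rcases J with - | j
    · simp only [Finset.range_zero, Finset.notMem_empty, Set.iUnion_of_empty, Set.iUnion_empty,
        measureReal_empty]
      positivity
    have hj := hmin j j.lt_succ_self
    have h3 := le_log_card hε hε1 hG hj
    have h2 := round_mul_le hε hε1 hG hj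
    rw [← hn, ← hΛ] at h2 h3
    have hε2 : ε ^ 2 ≤ 1 := by nlinarith
    have hΛ1 : 1000 ≤ Λ := by
      by_contra! h
      have : 0 ≤ Λ := hΛ ▸ Real.log_nonneg (by linarith)
      nlinarith
    have hDn : (D.card : ℝ) ≤ n := by rw [hn]; exact_mod_cast Finset.card_le_univ D
    have h10 : 1000 * Λ ^ 10 ≤ n := by
      refine le_trans ?_ (hN.trans hDn)
      calc 1000 * Λ ^ 10 ≤ Λ * Λ ^ 10 := by gcongr
        _ = Λ ^ 11 := by ring
        _ ≤ Λ ^ 18 := pow_le_pow_right₀ (by linarith) (by norm_num)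
    have hJn : 4 * (((j + 1 : ℕ) : ℝ)) ≤ n := by
      push_cast
      have h4 : ((j : ℝ) + 1) * 1000 ≤ 3 * ε * Λ ^ 2 := by
        have h6 : ((j : ℝ) + 1) * 1000 ≤ ((j : ℝ) + 1) * (ε ^ 2 * Λ) := by gcongr
        have h7 : ((j : ℝ) + 1) * ε * (ε * Λ) ≤ 3 * Λ * (ε * Λ) := by
          have : 0 ≤ ε * Λ := by positivity
          gcongr
        linarith
      have h5 : Λ ^ 2 ≤ Λ ^ 10 := pow_le_pow_right₀ (by linarith) (by norm_num)
      have h6 : 3 * ε * Λ ^ 2 ≤ 3 * (1 / 1000) * Λ ^ 10 := by gcongr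
      have h7 : 0 ≤ Λ ^ 10 := by positivity
      linarith
    refine le_trans ((measureReal_biUnion_finset_le _ _).trans ?_)
      (failure_sum_le (Λ := Λ) (J := ((j + 1 : ℕ) : ℝ)) (by rw [hΛ, Real.exp_log (by linarith)])
        (by linarith) (by positivity) hJn)
    calc _ ≤ ∑ i ∈ Finset.range (j + 1), (n * (2 * Real.exp (-(100 * Λ))) + Real.exp (-(8 * Λ))) := by
          refine Finset.sum_le_sum fun i hi => (measureReal_union_le _ _).trans ?_
          have hi' := hmin i (Finset.mem_range.1 hi)
          refine add_le_add ?_ ?_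
          · rw [hΛ]; exact prob_fine_failure_le hS hε hε1 hG hC hi'
          · refine prob_coarse_failure_le hS hε hε1 hG hC hi' hΛ (by positivity) ?_
            have : 0 ≤ Λ ^ 10 := by positivity
            linarith
      _ = _ := by rw [Finset.sum_const, Finset.card_range, nsmul_eq_mul]
  have huniv : 1 ≤ μ.real good + μ.real goodᶜ := by
    have := measureReal_union_le (μ := μ) good goodᶜ
    rwa [Set.union_compl_self, probReal_univ] at this
  linarith

lemma exists_finset_isVertexCover (G : SimpleGraph V) :
    ∃ D : Finset V, D.card = G.vertexCoverNum.toNat ∧ G.IsVertexCover (D : Set V) := by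
  obtain ⟨s, hs, hc⟩ := SimpleGraph.vertexCoverNum_exists G
  refine ⟨s.toFinset, ?_, by simpa using hc⟩
  rw [← hs, ← Set.ncard_eq_toFinset_card']
  rfl

lemma eq_bot_of_maxDegree (hG : ¬ 0 < G.maxDegree) : G = ⊥ := by
  rw [SimpleGraph.eq_bot_iff_forall_not_adj]
  intro u v huv
  exact hG (((G.degree_pos_iff_exists_adj u).2 ⟨v, huv⟩).trans_le (G.degree_le_maxDegree u))

end Approximation

end LowAwake

theorem mainTheorem5 :
    (∀ ε : ℝ, 0 < ε → ε ≤ 1 / 1000 → ∀ C : ℝ, 0 < C →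
      ∀ {V : Type*} [Fintype V] (G : SimpleGraph V) (S : ℕ → ℕ → Set V),
        G.IsVertexCover (LowAwake.frozenSet G ε C S)) ∧
    ∃ K c₀ : ℝ, 0 < K ∧ 0 < c₀ ∧
      ∀ ε : ℝ, 0 < ε → ε ≤ 1 / 1000 → ∀ C : ℝ, c₀ / ε ^ 2 ≤ C →
      ∀ {V : Type*} [Fintype V] (G : SimpleGraph V),
        K * Real.log (Fintype.card V) ^ 18 ≤ (G.vertexCoverNum.toNat : ℝ) →
        ∀ {Ω : Type*} [MeasurableSpace Ω] (μ : Measure Ω) [IsProbabilityMeasure μ]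
          (S : Ω → ℕ → ℕ → Set V), LowAwake.IsSampling G ε C μ S →
          1 - 1 / (Fintype.card V : ℝ) ^ 6 ≤
            μ.real {ω | G.IsVertexCover (LowAwake.frozenSet G ε C (S ω)) ∧
              ((LowAwake.frozenSet G ε C (S ω)).ncard : ℝ) ≤
                (2 + 100 * ε) * (G.vertexCoverNum.toNat : ℝ)} := by
  classical
  refine ⟨?_, 1, 400, one_pos, by norm_num, ?_⟩
  · intro ε hε hε1 C _ V _ G S
    by_cases hG : 0 < @SimpleGraph.maxDegree V G _ (fun _ _ => Classical.propDecidable _)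
    · exact LowAwake.isVertexCover_frozenSet hε (LowAwake.exists_isVanillaRound hε hε1 hG)
    · rw [LowAwake.eq_bot_of_maxDegree hG]
      simp
  · intro ε hε hε1 C hC V _ G hK Ω _ μ _ S hS
    obtain ⟨D, hDcard, hD⟩ := LowAwake.exists_finset_isVertexCover G
    rw [← hDcard] at hK ⊢
    by_cases hG : 0 < @SimpleGraph.maxDegree V G _ (fun _ _ => Classical.propDecidable _)
    · exact LowAwake.prob_approximation hS hε hε1 hG hC hD (by simpa using hK)
    · have hbot := LowAwake.eq_bot_of_maxDegree hG
      have huniv : {ω | G.IsVertexCover (LowAwake.frozenSet G ε C (S ω)) ∧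
          ((LowAwake.frozenSet G ε C (S ω)).ncard : ℝ) ≤ (2 + 100 * ε) * (D.card : ℝ)} =
          Set.univ := by
        ext ω
        simp only [LowAwake.frozenSet_eq_empty hbot, Set.ncard_empty, Set.mem_univ, iff_true]
        refine ⟨by simp [hbot], ?_⟩
        push_cast
        positivity
      rw [huniv, probReal_univ]
      have : 0 ≤ 1 / (Fintype.card V : ℝ) ^ 6 := by positivity
      linarith
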